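/- Let $G$ be a group which is hyperbolic relative to a finite collection $\mathbb P$ of subgroups, in the following sense: $G$ acts properly discontinuously and by isometries on a proper geodesic $\delta$-hyperbolic space $X$; there is a $G$-equivariant collection of pairwise disjoint open horoballs, one centered at each parabolic point of $G$ in $\partial X$, with union $U$, such that $G$ acts cocompactly on $X-U$; and $\mathbb P$ is a finite set of representatives of the conjugacy classes of maximal parabolic subgroups of $G$. Here a subgroup of $G$ is parabolic if it is infinite, contains no loxodromic element and fixes a point of $\partial X$; such a point is called a parabolic point. Fix a basepoint $x_0\in X-U$. A subgroup $Q\le G$ is relatively quasiconvex if there is $\mu\ge 0$ such that $c\cap (X-U)$ lies in the $\mu$-neighbourhood of $Qx_0$ for every geodesic $c$ in $X$ with endpoints in $Qx_0$. Let $Q$ and $R$ be relatively quasiconvex subgroups of $G$ with compatible parabolic subgroups, that is, for every maximal parabolic subgroup $P$ of $G$ either $Q\cap P\le R\cap P$ or $R\cap P\le Q\cap P$. Suppose that $Q\cap R$ is separable in $G$, that is, an intersection of finite index subgroups of $G$. Then there are finite index subgroups $Q'\le Q$ and $R'\le R$ such that the natural homomorphism $Q' *_{Q'\cap R'} R' \to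 G$ is injective and its image $\langle Q'\cup R'\rangle$ is relatively quasiconvex in $G$. -/

import Mathlib

namespace RelHyp

open Set NNReal

/-! ### Geodesics and hyperbolic spaces -/

section Metric

variable (X : Type*) [MetricSpace X]

/-- `c` restricts to a geodesic of length `L` from `x` to `y` (parametrized by arc length on
`[0, L]`; the values of `c` outside `[0, L]` are irrelevant). -/
structure IsGeodesic {X : Type*} [MetricSpace X] (c : ℝ → X) (L : ℝ) (x y : X) : Prop where
  nonneg : 0 ≤ L
  source : c 0 = x
  target : c L = y
  isometric : ∀ s ∈ Icc 0 L, ∀ t ∈ Icc 0 L, dist (c s) (c t) = |s - t|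

/-- `S` is the image of a geodesic segment from `x` to `y`. -/
def IsGeodesicSegment {X : Type*} [MetricSpace X] (S : Set X) (x y : X) : Prop :=
  ∃ (c : ℝ → X) (L : ℝ), IsGeodesic c L x y ∧ S = c '' Icc 0 L

/-- Any two points are joined by a geodesic segment. -/
def IsGeodesicSpace : Prop :=
  ∀ x y : X, ∃ S : Set X, IsGeodesicSegment S x y

/-- All geodesic triangles are `δ`-slim: each side lies in the closed `δ`-neighbourhood of the
union of the two other sides. -/
def IsDeltaHyperbolic (δ : ℝ) : Prop :=
  ∀ (x y z : X) (A B C : Set X),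
    IsGeodesicSegment A x y → IsGeodesicSegment B y z → IsGeodesicSegment C x z →
    ∀ p ∈ A, ∃ q ∈ B ∪ C, dist p q ≤ δ

/-- A geodesic ray, parametrized by arc length on `[0, ∞)`. -/
structure GeodesicRay where
  toFun : ℝ≥0 → X
  isometry : Isometry toFun

/-- Two geodesic rays are asymptotic if they stay at bounded distance from each other. -/
def asymptoticSetoid : Setoid (GeodesicRay X) where
  r c d := ∃ C : ℝ, ∀ t, dist (c.toFun t) (d.toFun t) ≤ C
  iseqv :=
    { refl := fun c => ⟨0, fun t => by simp⟩
      symm := fun {c d} ⟨C, h⟩ => ⟨C, fun t => by rw [dist_comm]; exact h t⟩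
      trans := fun {c d e} ⟨C, h⟩ ⟨D, k⟩ =>
        ⟨C + D, fun t => (dist_triangle _ (d.toFun t) _).trans (add_le_add (h t) (k t))⟩ }

/-- The boundary at infinity `∂X` (for proper geodesic hyperbolic `X`): geodesic rays up to the
asymptotic relation. -/
def Boundary : Type _ := Quotient (asymptoticSetoid X)

variable {X}

/-- The endpoint at infinity of a geodesic ray. -/
def GeodesicRay.endpoint (c : GeodesicRay X) : Boundary X :=
  Quotient.mk (asymptoticSetoid X) c

/-! ### Horofunctions and horoballs -/

/-- `w` is an `r`-center of some geodesic triangle with vertices `x, y ∈ X` and `ξ ∈ ∂X`: the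
closed `r`-ball about `w` meets all three sides. -/
def IsCenter (r : ℝ) (x y : X) (ξ : Boundary X) (w : X) : Prop :=
  ∃ (S : Set X) (c d : GeodesicRay X),
    IsGeodesicSegment S x y ∧
    c.toFun 0 = x ∧ c.endpoint = ξ ∧ d.toFun 0 = y ∧ d.endpoint = ξ ∧
    (∃ p ∈ S, dist w p ≤ r) ∧ (∃ t, dist w (c.toFun t) ≤ r) ∧ (∃ t, dist w (d.toFun t) ≤ r)

/-- `h` is a horofunction centered at `ξ` (with the convention that `h` increases towards `ξ`):
`h x + d(x, w)` and `h y + d(y, w)` agree up to a uniform constant whenever `w` is a center of a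
geodesic triangle with vertices `x, y, ξ`.  In a hyperbolic space any two centers of a triangle
are at bounded distance, so the condition does not depend on the radius `r` used for centers as
soon as `r` is large enough for centers to exist; here it is required for all `r`. -/
def IsHorofunction (h : X → ℝ) (ξ : Boundary X) : Prop :=
  ∀ r : ℝ, ∃ D : ℝ, ∀ x y w : X, IsCenter r x y ξ w →
    |(h x + dist x w) - (h y + dist y w)| ≤ D

/-- `B` is a horoball centered at `ξ`: a superlevel set, up to a bounded error, of a horofunction
centered at `ξ`. -/
def IsHoroball (B : Set X) (ξ : Boundary X) : Prop :=
  ∃ (h : X → ℝ) (D : ℝ), IsHorofunction h ξ ∧ (∀ x ∈ B, -D ≤ h x) ∧ (∀ x ∉ B, h x ≤ D)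

end Metric

/-! ### Isometric actions, parabolic subgroups, relative hyperbolicity -/

section Action

variable {G : Type*} {X : Type*} [Group G] [MetricSpace X] [MulAction G X] [IsIsometricSMul G X]

/-- The translate of a geodesic ray by an isometry. -/
def GeodesicRay.translate (g : G) (c : GeodesicRay X) : GeodesicRay X where
  toFun t := g • c.toFun t
  isometry := (isometry_smul X g).comp c.isometry

/-- The induced action on the boundary. -/
instance : MulAction G (Boundary X) where
  smul g := Quotient.map (GeodesicRay.translate g) (fun _ _ ⟨C, h⟩ =>
    ⟨C, fun t => by simpa [GeodesicRay.translate] using h t⟩)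
  one_smul ξ := by
    induction ξ using Quotient.inductionOn with
    | h c => exact congrArg (Quotient.mk _) (by simp [GeodesicRay.translate])
  mul_smul g k ξ := by
    induction ξ using Quotient.inductionOn with
    | h c => exact congrArg (Quotient.mk _) (by simp [GeodesicRay.translate, mul_smul])

variable (X) in
/-- `g` acts loxodromically: its stable translation length `inf_{n ≥ 1} d(x, gⁿ x) / n` is
positive, i.e. its orbits are quasi-isometrically embedded copies of `ℤ`. -/
def IsLoxodromic (g : G) : Prop :=
  ∃ c : ℝ, 0 < c ∧ ∀ (x : X) (n : ℕ), c * n ≤ dist x (g ^ n • x)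

/-- `P` is a parabolic subgroup fixing `ξ`: it is infinite, contains no loxodromic element and
fixes the point `ξ` at infinity. -/
def IsParabolicAt (P : Subgroup G) (ξ : Boundary X) : Prop :=
  (P : Set G).Infinite ∧ (∀ g ∈ P, ¬ IsLoxodromic X g) ∧ ∀ g ∈ P, g • ξ = ξ

variable (X) in
/-- `P` is a maximal parabolic subgroup (maximal with respect to inclusion). -/
def IsMaximalParabolic (P : Subgroup G) : Prop :=
  Maximal (fun P : Subgroup G => ∃ ξ : Boundary X, IsParabolicAt P ξ) P

variable (G) in
/-- `ξ` is a parabolic point: it is fixed by some parabolic subgroup of `G`. -/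
def IsParabolicPoint (ξ : Boundary X) : Prop :=
  ∃ P : Subgroup G, IsParabolicAt P ξ

variable (G) in
/-- The union `U` of the horoballs `B ξ`, where `ξ` ranges over the parabolic points of `G`. -/
def horoballUnion (B : Boundary X → Set X) : Set X :=
  {x | ∃ ξ, IsParabolicPoint G ξ ∧ x ∈ B ξ}

variable (G X) in
/-- The action of `G` on `X`, together with the horoballs `B ξ` centered at the parabolic points
`ξ` of `G` (other values of `B` are irrelevant), exhibits `G` as hyperbolic relative to the finite
collection `Par` of subgroups. -/
structure IsRelHypAction [ProperSpace X] [ProperlyDiscontinuousSMul G X]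
    (Par : Set (Subgroup G)) (B : Boundary X → Set X) : Prop where
  geodesic : IsGeodesicSpace X
  hyperbolic : ∃ δ : ℝ, IsDeltaHyperbolic X δ
  /-- Each `B ξ` is an open horoball centered at `ξ`. -/
  horoball : ∀ ξ, IsParabolicPoint G ξ → IsHoroball (B ξ) ξ
  isOpen : ∀ ξ, IsParabolicPoint G ξ → IsOpen (B ξ)
  /-- The collection of horoballs is equivariant. -/
  equivariant : ∀ (g : G) ξ, IsParabolicPoint G ξ → B (g • ξ) = (fun x => g • x) '' B ξ
  /-- Distinct horoballs are disjoint. -/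
  disjoint : ∀ ξ η, IsParabolicPoint G ξ → IsParabolicPoint G η → ξ ≠ η → Disjoint (B ξ) (B η)
  /-- `G` acts cocompactly on the complement of the horoballs. -/
  cocompact : ∃ K : Set X, IsCompact K ∧ (⋃ g : G, (fun x => g • x) '' K) = (horoballUnion G B)ᶜ
  /-- `Par` is a finite set of representatives of the conjugacy classes of maximal parabolic
  subgroups. -/
  finite : Par.Finite
  maximalParabolic : ∀ P ∈ Par, IsMaximalParabolic X P
  representative : ∀ P : Subgroup G, IsMaximalParabolic X P →
    ∃! P₀ : Subgroup G, P₀ ∈ Par ∧ ∃ g : G, P = P₀.map (MulAut.conj g).toMonoidHom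

/-- `Q` is relatively quasiconvex (for the action on `X`, the horoballs `B` and the basepoint
`x₀`): there is `μ ≥ 0` such that every geodesic with endpoints in `Q x₀` meets the complement
of the horoballs inside the `μ`-neighbourhood of `Q x₀`. -/
def IsRelQuasiconvex (B : Boundary X → Set X) (x₀ : X) (Q : Subgroup G) : Prop :=
  ∃ μ : ℝ, 0 ≤ μ ∧ ∀ q₁ ∈ Q, ∀ q₂ ∈ Q, ∀ S : Set X,
    IsGeodesicSegment S (q₁ • x₀) (q₂ • x₀) →
      ∀ p ∈ S, p ∉ horoballUnion G B → ∃ q ∈ Q, dist p (q • x₀) ≤ μ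

variable (X) in
/-- `Q` and `R` have compatible parabolic subgroups. -/
def HaveCompatibleParabolics (Q R : Subgroup G) : Prop :=
  ∀ P : Subgroup G, IsMaximalParabolic X P → Q ⊓ P ≤ R ⊓ P ∨ R ⊓ P ≤ Q ⊓ P

end Action

/-! ### Separability and amalgams -/

section Groups

variable {G : Type*} [Group G]

/-- `H` is separable in `G`: it is an intersection of finite index subgroups of `G`. -/
def IsSeparableSubgroup (H : Subgroup G) : Prop :=
  ∀ g : G, g ∉ H → ∃ K : Subgroup G, K.FiniteIndex ∧ H ≤ K ∧ g ∉ K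

/-- The pair `(Q, R)` as a family indexed by `Bool`. -/
def pair (Q R : Subgroup G) : Bool → Subgroup G
  | true => Q
  | false => R

theorem inf_le_pair (Q R : Subgroup G) : ∀ b, Q ⊓ R ≤ pair Q R b
  | true => inf_le_left
  | false => inf_le_right

/-- The amalgamated free product `Q *_{Q ∩ R} R`: the pushout of the inclusions of `Q ∩ R` into
`Q` and `R`. -/
abbrev Amalgam (Q R : Subgroup G) : Type _ :=
  Monoid.PushoutI (fun b => Subgroup.inclusion (inf_le_pair Q R b))

/-- The natural homomorphism `Q *_{Q ∩ R} R → G` extending the inclusions of `Q` and `R`. -/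
def amalgamMap (Q R : Subgroup G) : Amalgam Q R →* G :=
  Monoid.PushoutI.lift (fun b => (pair Q R b).subtype) (Q ⊓ R).subtype (fun _ => rfl)

end Groups

end RelHyp

/-! The heart is `exists_inf_near_segment`: there is a constant `C` such that for all `q ∈ Q` and `r
∈ R` some `h ∈ Q ⊓ R` makes the Gromov product of `q x₀` and `r x₀` at `h x₀` at most `C`. Consider
a center of the triangle `x₀, q x₀, r x₀`. If it is not deep in a horoball, quasiconvexity puts it
near both orbits, and these are close to each other only near the orbit of `Q ⊓ R`
(`exists_near_inf`). If it is deep in the horoball at `ξ`, the two sides from `x₀` enter this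
horoball near a common point, and for the same reason some `h x₀` with `h ∈ Q ⊓ R` is nearby.
Suppose that, in the stabilizer of `h⁻¹ ξ`, the part of `Q` lies in that of `R`. The two sides at `q
x₀` also enter near a common point, which is close to `h k x₀` for some `k ∈ Q` fixing `h⁻¹ ξ`; then
`k ∈ R`, and `h k` is the required element. The other case uses the corner `r x₀`.

Separability yields a finite index `K ≥ Q ⊓ R` whose elements outside `Q ⊓ R` move `x₀` by more than
a prescribed `M`. Take `Q ⊓ K` and `R ⊓ K`, which still intersect in `Q ⊓ R`. An alternating word
traces a broken geodesic in the orbit with edges of length at least `M`. Inserting elements of `Q ⊓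
R` between the letters so that the total length is almost minimal bounds the Gromov products at the
vertices by `C + 1` (`IsAlternating.exists_straight`). If `M` is large, such a path has distinct
endpoints (`dist_origin_pos`), which gives injectivity, and a geodesic with the same endpoints
follows its edges (`exists_near_edge`), which together with quasiconvexity of `Q` and `R` gives
quasiconvexity of the join. -/

namespace RelHyp

open Set NNReal Filter Topology

/-! ### Slim triangles, Gromov products and geodesic rays. -/

section Hyperbolic

variable {X : Type*} [MetricSpace X]

namespace IsGeodesic

variable {c : ℝ → X} {L : ℝ} {x y : X}

theorem dist_eq (hc : IsGeodesic c L x y) : dist x y = L := by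
  have := hc.isometric 0 ⟨le_rfl, hc.nonneg⟩ L ⟨hc.nonneg, le_rfl⟩
  rwa [hc.source, hc.target, zero_sub, abs_neg, abs_of_nonneg hc.nonneg] at this

theorem dist_source (hc : IsGeodesic c L x y) {t : ℝ} (ht : t ∈ Icc 0 L) : dist x (c t) = t := by
  have := hc.isometric 0 ⟨le_rfl, hc.nonneg⟩ t ht
  rwa [hc.source, zero_sub, abs_neg, abs_of_nonneg ht.1] at this

theorem dist_target (hc : IsGeodesic c L x y) {t : ℝ} (ht : t ∈ Icc 0 L) :
    dist (c t) y = L - t := by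
  have := hc.isometric t ht L ⟨hc.nonneg, le_rfl⟩
  rwa [hc.target, abs_sub_comm, abs_of_nonneg (sub_nonneg.2 ht.2)] at this

theorem reverse (hc : IsGeodesic c L x y) : IsGeodesic (fun t => c (L - t)) L y x where
  nonneg := hc.nonneg
  source := by simpa using hc.target
  target := by simpa using hc.source
  isometric s hs t ht := by
    rw [hc.isometric _ ⟨by linarith [hs.2], by linarith [hs.1]⟩ _
      ⟨by linarith [ht.2], by linarith [ht.1]⟩, abs_sub_comm]
    congr 1; ring

theorem sub (hc : IsGeodesic c L x y) {a b : ℝ} (ha : 0 ≤ a) (hab : a ≤ b) (hb : b ≤ L) :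
    IsGeodesic (fun t => c (a + t)) (b - a) (c a) (c b) where
  nonneg := sub_nonneg.2 hab
  source := by simp
  target := by simp
  isometric s hs t ht := by
    rw [hc.isometric _ ⟨by linarith [hs.1], by linarith [hs.2]⟩ _
      ⟨by linarith [ht.1], by linarith [ht.2]⟩]
    congr 1; ring

theorem continuousOn (hc : IsGeodesic c L x y) : ContinuousOn c (Icc 0 L) := by
  refine Metric.continuousOn_iff.2 fun b hb ε hε => ⟨ε, hε, fun a ha hab => ?_⟩
  rwa [hc.isometric a ha b hb, ← Real.dist_eq]

theorem segment (hc : IsGeodesic c L x y) : IsGeodesicSegment (c '' Icc 0 L) x y :=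
  ⟨c, L, hc, rfl⟩

theorem segment_sub (hc : IsGeodesic c L x y) {a b : ℝ} (ha : 0 ≤ a) (hab : a ≤ b) (hb : b ≤ L) :
    IsGeodesicSegment (c '' Icc a b) (c a) (c b) := by
  refine ⟨_, _, hc.sub ha hab hb, ?_⟩
  have : (fun t => c (a + t)) = c ∘ fun t => a + t := rfl
  rw [this, image_comp, image_const_add_Icc]
  simp

end IsGeodesic

namespace IsGeodesicSegment

variable {S : Set X} {x y : X}

theorem symm (h : IsGeodesicSegment S x y) : IsGeodesicSegment S y x := by
  obtain ⟨c, L, hc, rfl⟩ := h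
  refine ⟨_, L, hc.reverse, ?_⟩
  have : (fun t => c (L - t)) = c ∘ fun t => L - t := rfl
  rw [this, image_comp, image_const_sub_Icc]
  simp

theorem dist_add (h : IsGeodesicSegment S x y) {p : X} (hp : p ∈ S) :
    dist x p + dist p y = dist x y := by
  obtain ⟨c, L, hc, rfl⟩ := h
  obtain ⟨t, ht, rfl⟩ := hp
  rw [hc.dist_source ht, hc.dist_target ht, hc.dist_eq]
  ring

theorem left_mem (h : IsGeodesicSegment S x y) : x ∈ S := by
  obtain ⟨c, L, hc, rfl⟩ := h
  exact ⟨0, ⟨le_rfl, hc.nonneg⟩, hc.source⟩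

theorem right_mem (h : IsGeodesicSegment S x y) : y ∈ S := h.symm.left_mem

end IsGeodesicSegment

/-- A path covered by the `r`-neighbourhoods of two sets, starting in one and ending in the other,
has a point near both. -/
theorem exists_near_both {c : ℝ → X} {L r : ℝ} {A B : Set X} (hL : 0 ≤ L)
    (hc : ContinuousOn c (Icc 0 L)) (h0 : ∃ q ∈ A, dist (c 0) q ≤ r)
    (h1 : ∃ q ∈ B, dist (c L) q ≤ r)
    (h : ∀ t ∈ Icc 0 L, (∃ q ∈ A, dist (c t) q ≤ r) ∨ ∃ q ∈ B, dist (c t) q ≤ r) :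
    ∃ t ∈ Icc 0 L, (∃ q ∈ A, dist (c t) q ≤ r + 1) ∧ ∃ q ∈ B, dist (c t) q ≤ r + 1 := by
  have key : ∀ (E : Set X) (p : X), (∃ q ∈ E, dist p q ≤ r) → Metric.infDist p E ≤ r :=
    fun E p ⟨q, hq, hpq⟩ => (Metric.infDist_le_dist_of_mem hq).trans hpq
  have cl : ∀ E : Set X, IsClosed {p : X | Metric.infDist p E ≤ r} := fun E =>
    isClosed_le (Metric.continuous_infDist_pt E) continuous_const
  have hI : IsPreconnected (c '' Icc 0 L) := isPreconnected_Icc.image c hc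
  have := isPreconnected_closed_iff.1 hI _ _ (cl A) (cl B)
    (by
      rintro _ ⟨t, ht, rfl⟩
      exact (h t ht).imp (key A _) (key B _))
    ⟨c 0, ⟨0, ⟨le_rfl, hL⟩, rfl⟩, key A _ h0⟩ ⟨c L, ⟨L, ⟨hL, le_rfl⟩, rfl⟩, key B _ h1⟩
  obtain ⟨_, ⟨t, ht, rfl⟩, hA, hB⟩ := this
  obtain ⟨a, ha, -⟩ := h0
  obtain ⟨b, hb, -⟩ := h1
  -- The distance to a set need not be attained, whence the `+ 1`.
  obtain ⟨q, hq, hq'⟩ := (Metric.infDist_lt_iff ⟨a, ha⟩).1 (lt_of_le_of_lt hA (lt_add_one r))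
  obtain ⟨q₂, hq₂, hq₂'⟩ := (Metric.infDist_lt_iff ⟨b, hb⟩).1 (lt_of_le_of_lt hB (lt_add_one r))
  exact ⟨t, ht, ⟨q, hq, hq'.le⟩, q₂, hq₂, hq₂'.le⟩

variable {δ : ℝ}

theorem IsDeltaHyperbolic.nonneg (hδ : IsDeltaHyperbolic X δ) (x : X) : 0 ≤ δ := by
  have h : IsGeodesicSegment {x} x x := ⟨fun _ => x, 0,
    ⟨le_rfl, rfl, rfl, fun s hs t ht => by
      rw [Icc_self] at hs ht
      rw [mem_singleton_iff.1 hs, mem_singleton_iff.1 ht]; simp⟩, by simp⟩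
  obtain ⟨q, -, hq⟩ := hδ x x x _ _ _ h h h x rfl
  exact dist_nonneg.trans hq

/-- The side `A` is connected and covered by the closed `δ`-neighbourhoods of the other two sides.
-/
theorem exists_triangle_center (hδ : IsDeltaHyperbolic X δ) {x y z : X} {A B C : Set X}
    (hA : IsGeodesicSegment A x y) (hB : IsGeodesicSegment B y z) (hC : IsGeodesicSegment C x z) :
    ∃ p ∈ A, (∃ q ∈ B, dist p q ≤ δ + 1) ∧ ∃ q ∈ C, dist p q ≤ δ + 1 := by
  have hδ0 := hδ.nonneg x
  have hA' := hA
  obtain ⟨c, L, hc, rfl⟩ := hA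
  obtain ⟨t, ht, h₁, h₂⟩ := exists_near_both (r := δ) (A := C) (B := B) hc.nonneg hc.continuousOn
    ⟨x, hC.left_mem, by simpa [hc.source] using hδ0⟩
    ⟨y, hB.left_mem, by simpa [hc.target] using hδ0⟩ (fun t ht => by
      obtain ⟨q, hq | hq, hd⟩ := hδ x y z _ B C hA' hB hC (c t) ⟨t, ht, rfl⟩
      · exact Or.inr ⟨q, hq, hd⟩
      · exact Or.inl ⟨q, hq, hd⟩)
  exact ⟨c t, ⟨t, ht, rfl⟩, h₂, h₁⟩

theorem IsGeodesicSegment.dist_add_le {S : Set X} {x y p q : X} {r : ℝ}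
    (h : IsGeodesicSegment S x y) (hq : q ∈ S) (hpq : dist p q ≤ r) :
    dist x p + dist p y ≤ dist x y + 2 * r := by
  have h1 := h.dist_add hq
  have h2 := dist_triangle x q p
  have h3 := dist_triangle p q y
  rw [dist_comm q p] at h2
  linarith

/-- The four-point inequality. -/
theorem four_point (hX : IsGeodesicSpace X) (hδ : IsDeltaHyperbolic X δ) (x y z w : X) :
    dist x z + dist y w ≤ max (dist x y + dist z w) (dist x w + dist y z) + 4 * (δ + 1) := by
  obtain ⟨A, hA⟩ := hX x z
  obtain ⟨B, hB⟩ := hX z y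
  obtain ⟨C, hC⟩ := hX x y
  obtain ⟨E, hE⟩ := hX z w
  obtain ⟨F, hF⟩ := hX x w
  obtain ⟨p, hp, ⟨q, hq, hpq⟩, q', hq', hpq'⟩ := exists_triangle_center hδ hA hB hC
  have h1 := hB.dist_add_le hq hpq
  have h2 := hC.dist_add_le hq' hpq'
  have hA' := hA.dist_add hp
  have t1 := dist_triangle y p w
  have e1 := dist_comm z p
  have e2 := dist_comm z y
  have e3 := dist_comm p y
  -- The detour of every path through `p` is already bounded for the pairs `x, y` and `z, y`;
  -- slimness of the triangle `x z w` bounds it for `z, w` or for `x, w`, and this decides which sum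
  -- attains the bound.
  obtain ⟨u, hu | hu, hpu⟩ := hδ x z w A E F hA hE hF p hp
  · have h3 := hE.dist_add_le hu hpu
    have := le_max_left (dist x y + dist z w) (dist x w + dist y z)
    linarith
  · have h3 := hF.dist_add_le hu hpu
    have := le_max_right (dist x y + dist z w) (dist x w + dist y z)
    linarith

/-- A center of the triangle `x y p` on the side `S` is almost on both sides at `p`, so its distance
to `p` is about the Gromov product of `x` and `y` at `p`. -/
theorem exists_near_of_dist_add_le (hX : IsGeodesicSpace X) (hδ : IsDeltaHyperbolic X δ)
    {S : Set X} {x y p : X} {C : ℝ} (hS : IsGeodesicSegment S x y)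
    (hp : dist x p + dist p y ≤ dist x y + 2 * C) : ∃ q ∈ S, dist p q ≤ C + 2 * (δ + 1) := by
  obtain ⟨A, hA⟩ := hX y p
  obtain ⟨B, hB⟩ := hX x p
  obtain ⟨q, hq, ⟨a, ha, hqa⟩, b, hb, hqb⟩ := exists_triangle_center hδ hS hA hB
  refine ⟨q, hq, ?_⟩
  have h1 := hA.dist_add_le ha hqa
  have h2 := hB.dist_add_le hb hqb
  have h3 := hS.dist_add hq
  have e1 := dist_comm y q
  have e2 := dist_comm q p
  have e3 := dist_comm y p
  linarith

theorem slim_quadrilateral (hX : IsGeodesicSpace X) (hδ : IsDeltaHyperbolic X δ)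
    {x y z w : X} {A B C D : Set X} (hA : IsGeodesicSegment A x y) (hB : IsGeodesicSegment B y z)
    (hC : IsGeodesicSegment C z w) (hD : IsGeodesicSegment D x w) {p : X} (hp : p ∈ A) :
    ∃ q ∈ B ∪ C ∪ D, dist p q ≤ 2 * δ := by
  have hδ0 := hδ.nonneg x
  obtain ⟨E, hE⟩ := hX x z
  obtain ⟨q, hq | hq, hpq⟩ := hδ x y z A B E hA hB hE p hp
  · exact ⟨q, Or.inl (Or.inl hq), by linarith⟩
  · obtain ⟨u, hu, hqu⟩ := hδ x z w E C D hE hC hD q hq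
    refine ⟨u, ?_, by linarith [dist_triangle p q u]⟩
    rcases hu with hu | hu
    · exact Or.inl (Or.inr hu)
    · exact Or.inr hu

namespace GeodesicRay

theorem dist_eq (c : GeodesicRay X) (s t : ℝ≥0) :
    dist (c.toFun s) (c.toFun t) = |(s : ℝ) - t| := by
  rw [c.isometry.dist_eq, NNReal.dist_eq]

theorem isGeodesic (c : GeodesicRay X) (n : ℝ≥0) :
    IsGeodesic (fun t => c.toFun t.toNNReal) n (c.toFun 0) (c.toFun n) where
  nonneg := n.2
  source := by simp
  target := by simp
  isometric s hs t ht := by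
    rw [c.dist_eq, Real.coe_toNNReal _ hs.1, Real.coe_toNNReal _ ht.1]

theorem segment (c : GeodesicRay X) (n : ℝ≥0) :
    IsGeodesicSegment (c.toFun '' Icc 0 n) (c.toFun 0) (c.toFun n) := by
  refine ⟨_, _, c.isGeodesic n, ?_⟩
  ext p
  constructor
  · rintro ⟨s, hs, rfl⟩
    exact ⟨s, ⟨s.coe_nonneg, NNReal.coe_le_coe.2 hs.2⟩, by simp⟩
  · rintro ⟨s, hs, rfl⟩
    exact ⟨s.toNNReal, ⟨by simp, Real.toNNReal_le_iff_le_coe.2 hs.2⟩, rfl⟩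

/-- The subray starting at time `s`. -/
def shift (c : GeodesicRay X) (s : ℝ≥0) : GeodesicRay X where
  toFun t := c.toFun (s + t)
  isometry := c.isometry.comp (Isometry.of_dist_eq fun a b => by
    simp [NNReal.dist_eq])

theorem shift_endpoint (c : GeodesicRay X) (s : ℝ≥0) : (c.shift s).endpoint = c.endpoint := by
  refine Quotient.sound ⟨s, fun t => ?_⟩
  simp only [shift]
  rw [c.dist_eq]
  simp

theorem exists_asymptotic_bound {c d : GeodesicRay X} (h : c.endpoint = d.endpoint) :
    ∃ C : ℝ, ∀ t, dist (c.toFun t) (d.toFun t) ≤ C :=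
  Quotient.exact h

end GeodesicRay

theorem ideal_slim_side (hX : IsGeodesicSpace X) (hδ : IsDeltaHyperbolic X δ)
    {S : Set X} {x y : X} (hS : IsGeodesicSegment S x y) {a b : GeodesicRay X}
    (ha : a.toFun 0 = x) (hb : b.toFun 0 = y) (hab : a.endpoint = b.endpoint) {p : X}
    (hp : p ∈ S) : (∃ s, dist p (a.toFun s) ≤ 2 * δ) ∨ ∃ s, dist p (b.toFun s) ≤ 2 * δ := by
  obtain ⟨C, hC⟩ := GeodesicRay.exists_asymptotic_bound hab
  -- Cutting the rays at time `n ≥ N` leaves a far side of length at most `C`, too remote to be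
  -- within `2 * δ` of `p`.
  set N : ℝ := 2 * δ + C + dist x p + 1
  set n : ℝ≥0 := N.toNNReal
  have hn : N ≤ n := Real.le_coe_toNNReal N
  have hA := ha ▸ a.segment n
  have hB := hb ▸ b.segment n
  obtain ⟨T, hT⟩ := hX (b.toFun n) (a.toFun n)
  obtain ⟨q, (hq | hq) | hq, hpq⟩ := slim_quadrilateral hX hδ hS hB hT hA hp
  · obtain ⟨s, -, rfl⟩ := hq
    exact Or.inr ⟨s, hpq⟩
  · exfalso
    have h1 := hT.dist_add hq
    have h2 := hA.dist_add hA.right_mem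
    have h3 := a.dist_eq 0 n
    rw [ha] at h3
    simp at h3
    have h4 := dist_triangle4 x p q (a.toFun n)
    have h5 := hC n
    rw [dist_comm] at h5
    have h6 : (0:ℝ) ≤ dist (b.toFun n) q := dist_nonneg
    simp only [N] at hn
    linarith
  · obtain ⟨s, -, rfl⟩ := hq
    exact Or.inl ⟨s, hpq⟩

theorem ideal_slim_ray (hX : IsGeodesicSpace X) (hδ : IsDeltaHyperbolic X δ)
    {S : Set X} {x y : X} (hS : IsGeodesicSegment S x y) {a b : GeodesicRay X}
    (ha : a.toFun 0 = x) (hb : b.toFun 0 = y) (hab : a.endpoint = b.endpoint) (s : ℝ≥0) :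
    (∃ q ∈ S, dist (a.toFun s) q ≤ 2 * δ) ∨ ∃ t, dist (a.toFun s) (b.toFun t) ≤ 2 * δ := by
  obtain ⟨C, hC⟩ := GeodesicRay.exists_asymptotic_bound hab
  set N : ℝ := 2 * δ + C + s + 1
  set n : ℝ≥0 := max s N.toNNReal
  have hn : N ≤ n := (Real.le_coe_toNNReal N).trans (NNReal.coe_le_coe.2 (le_max_right _ _))
  have hsn : s ≤ n := le_max_left _ _
  have hA := ha ▸ a.segment n
  have hB := hb ▸ b.segment n
  obtain ⟨T, hT⟩ := hX (a.toFun n) (b.toFun n)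
  obtain ⟨q, (hq | hq) | hq, hpq⟩ := slim_quadrilateral hX hδ hA hT hB.symm hS
    (p := a.toFun s) ⟨s, ⟨bot_le, hsn⟩, rfl⟩
  · exfalso
    have h1 := hT.dist_add hq
    have h3 := a.dist_eq s n
    rw [abs_sub_comm, abs_of_nonneg (sub_nonneg.2 (NNReal.coe_le_coe.2 hsn))] at h3
    have h4 := dist_triangle (a.toFun s) q (a.toFun n)
    have h5 := hC n
    have h6 : (0:ℝ) ≤ dist q (b.toFun n) := dist_nonneg
    rw [dist_comm q] at h4
    simp only [N] at hn
    linarith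
  · obtain ⟨t, -, rfl⟩ := hq
    exact Or.inr ⟨t, hpq⟩
  · exact Or.inl ⟨q, hq, hpq⟩

/-- Geodesics from `y` to the points `c n` of a ray representing `ξ` converge pointwise along an
ultrafilter, because closed balls are compact. Slim triangles keep the limit near `c`. -/
theorem exists_ray [ProperSpace X] (hX : IsGeodesicSpace X) (hδ : IsDeltaHyperbolic X δ) (y : X)
    (ξ : Boundary X) : ∃ d : GeodesicRay X, d.toFun 0 = y ∧ d.endpoint = ξ := by
  obtain ⟨c, rfl⟩ := Quotient.exists_rep ξ
  have hδ0 := hδ.nonneg y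
  have hex : ∀ n : ℕ, ∃ γ : ℝ → X, IsGeodesic γ (dist y (c.toFun n)) y (c.toFun n) := fun n => by
    obtain ⟨S, γ, L, hγ, -⟩ := hX y (c.toFun n)
    exact ⟨γ, by rw [hγ.dist_eq]; exact hγ⟩
  choose γ hγ using hex
  set L : ℕ → ℝ := fun n => dist y (c.toFun n)
  have hL : ∀ n : ℕ, (n : ℝ) - dist y (c.toFun 0) ≤ L n := fun n => by
    have h1 := c.dist_eq 0 n
    simp at h1
    have h2 := dist_triangle (c.toFun 0) y (c.toFun n)
    rw [dist_comm (c.toFun 0) y] at h2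
    simp only [L]
    linarith
  set U := hyperfilter ℕ
  have hU : (U : Filter ℕ) ≤ atTop := by
    rw [← Nat.cofinite_eq_atTop]; exact hyperfilter_le_cofinite
  have hev : ∀ t : ℝ, ∀ᶠ n in (U : Filter ℕ), t ≤ L n ∧ t ≤ n := fun t => hU <| by
    obtain ⟨N, hN⟩ := exists_nat_ge (t + dist y (c.toFun 0))
    filter_upwards [eventually_ge_atTop N] with n hn
    have : (N : ℝ) ≤ n := Nat.cast_le.2 hn
    have h0 : 0 ≤ dist y (c.toFun 0) := dist_nonneg
    exact ⟨by linarith [hL n], by linarith⟩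
  have hlim : ∀ t : ℝ≥0, ∃ z, Tendsto (fun n => γ n t) U (𝓝 z) := fun t => by
    have hmem : ∀ᶠ n in (U : Filter ℕ), γ n t ∈ Metric.closedBall y t := by
      filter_upwards [hev t] with n hn
      rw [Metric.mem_closedBall, dist_comm, (hγ n).dist_source ⟨t.coe_nonneg, hn.1⟩]
    obtain ⟨z, -, hz⟩ := (isCompact_closedBall y (t : ℝ)).ultrafilter_le_nhds
      (U.map fun n => γ n t) (le_principal_iff.2 hmem)
    exact ⟨z, hz⟩
  choose u hu using hlim
  have hiso : Isometry u := Isometry.of_dist_eq fun s t => by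
    refine tendsto_nhds_unique ((hu s).dist (hu t)) (tendsto_const_nhds.congr' ?_)
    filter_upwards [hev s, hev t] with n h1 h2
    rw [(hγ n).isometric _ ⟨s.coe_nonneg, h1.1⟩ _ ⟨t.coe_nonneg, h2.1⟩, NNReal.dist_eq]
  refine ⟨⟨u, hiso⟩, ?_, Quotient.sound ⟨3 * dist y (c.toFun 0) + 2 * δ, fun t => ?_⟩⟩
  · refine tendsto_nhds_unique (hu 0) (tendsto_const_nhds.congr fun n => ?_)
    exact ((hγ n).source).symm
  · refine le_of_tendsto ((hu t).dist tendsto_const_nhds) ?_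
    filter_upwards [hev t] with n hn
    obtain ⟨S, hS⟩ := hX y (c.toFun 0)
    have hp : γ n t ∈ γ n '' Icc 0 (L n) := ⟨t, ⟨t.coe_nonneg, hn.1⟩, rfl⟩
    have ht := (hγ n).dist_source ⟨t.coe_nonneg, hn.1⟩
    have hct := c.dist_eq 0 t
    simp at hct
    have h0 : 0 ≤ dist y (c.toFun 0) := dist_nonneg
    -- Near the ray, the parameters `s` and `t` differ by a bounded amount; near the side from `y`
    -- to `c 0`, the time `t` itself is bounded.
    obtain ⟨q, hq | hq, hd⟩ := hδ y (c.toFun n) (c.toFun 0) _ _ _ (hγ n).segment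
      (c.segment n).symm hS _ hp
    · obtain ⟨s, -, rfl⟩ := hq
      have h1 := dist_triangle4 y (c.toFun 0) (c.toFun s) (γ n t)
      have h2 := dist_triangle4 (c.toFun 0) y (γ n t) (c.toFun s)
      have h3 := dist_triangle (γ n t) (c.toFun s) (c.toFun t)
      have h4 := c.dist_eq 0 s
      simp at h4
      rw [dist_comm (c.toFun s) (γ n t)] at h1
      rw [dist_comm (c.toFun 0) y] at h2
      rw [c.dist_eq] at h3
      have h5 : |(s : ℝ) - t| ≤ dist y (c.toFun 0) + δ := abs_le.2 ⟨by linarith, by linarith⟩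
      linarith
    · have h1 := hS.dist_add hq
      have h2 := dist_triangle y q (γ n t)
      rw [dist_comm q] at h2
      have h3 := dist_triangle4 (γ n t) y (c.toFun 0) (c.toFun t)
      rw [dist_comm (γ n t) y] at h3
      have h4 : 0 ≤ dist q (c.toFun 0) := dist_nonneg
      linarith

end Hyperbolic

/-! ### Heights along geodesics and horoballs. -/

section Horoballs

variable {X : Type*} [MetricSpace X] {δ : ℝ}

/-- Metric data of a horoball `B`: along each geodesic the function `h` rises with slope one to a
peak and then descends with slope one, up to the error `D`; it can be increased with slope one
from every point; and `B` is a superlevel set of `h`, up to the error `D`. -/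
structure HoroData (B : Set X) (h : X → ℝ) (D : ℝ) : Prop where
  nonneg : 0 ≤ D
  of_mem : ∀ x ∈ B, -D ≤ h x
  of_notMem : ∀ x ∉ B, h x ≤ D
  peak : ∀ (c : ℝ → X) (L : ℝ) (x y : X), IsGeodesic c L x y →
    ∃ τ ∈ Icc 0 L, ∀ t ∈ Icc 0 L, |h (c t) - (h (c τ) - |t - τ|)| ≤ D
  up : ∀ (x : X) (s : ℝ), 0 ≤ s → ∃ y, dist x y ≤ s ∧ h x + s - D ≤ h y

/-- In the ideal triangle `x, c t, ξ`, the point `a s` near `c τ` is close to the ray from `c t`, or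
to the segment from `x` to `c t`. In the second case `c t`, which lies between that segment and `c
τ`, is itself close to `c τ`. -/
theorem isCenter_of_near_ray [ProperSpace X] (hX : IsGeodesicSpace X) (hδ : IsDeltaHyperbolic X δ)
    {c : ℝ → X} {L r : ℝ} {x y : X} (hc : IsGeodesic c L x y) {a : GeodesicRay X}
    (ha : a.toFun 0 = x) {τ : ℝ} (hτ : τ ∈ Icc 0 L) (hr : 0 ≤ r)
    (hs : ∃ s, dist (c τ) (a.toFun s) ≤ r) {t : ℝ} (ht : t ∈ Icc 0 τ) :
    IsCenter (r + 2 * δ) (c t) (c τ) a.endpoint (c τ) := by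
  have hδ0 := hδ.nonneg x
  obtain ⟨e, he0, he⟩ := exists_ray hX hδ (c t) a.endpoint
  obtain ⟨f, hf0, hf⟩ := exists_ray hX hδ (c τ) a.endpoint
  have hr' : 0 ≤ r + 2 * δ := by linarith
  have hS := hc.segment_sub ht.1 ht.2 hτ.2
  refine ⟨_, e, f, hS, he0, he, hf0, hf, ⟨c τ, hS.right_mem, by simpa⟩, ?_,
    ⟨0, by simpa [hf0]⟩⟩
  obtain ⟨s, hs⟩ := hs
  have hS' := hc.segment_sub le_rfl ht.1 (ht.2.trans hτ.2)
  rw [hc.source] at hS'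
  rcases ideal_slim_ray hX hδ hS' ha he0 he.symm s with ⟨_, ⟨u, hu, rfl⟩, hd⟩ | ⟨s', hd⟩
  · refine ⟨0, ?_⟩
    rw [he0]
    have h1 := dist_triangle (c τ) (a.toFun s) (c u)
    have h2 := hc.isometric τ hτ u ⟨hu.1, hu.2.trans (ht.2.trans hτ.2)⟩
    have h3 := hc.isometric τ hτ t ⟨ht.1, ht.2.trans hτ.2⟩
    rw [abs_of_nonneg (by linarith [hu.2, ht.2])] at h2 h3
    linarith [hu.2]
  · exact ⟨s', by linarith [dist_triangle (c τ) (a.toFun s) (e.toFun s')]⟩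

/-- By connectedness some `c τ` is near both rays from the endpoints to `ξ`. It is then a center of
the triangle `c t, c τ, ξ` for every `t`, and the defining property of a horofunction compares `h (c
t) + |t - τ|` with `h (c τ)`. -/
theorem IsHorofunction.exists_peak [ProperSpace X] (hX : IsGeodesicSpace X)
    (hδ : IsDeltaHyperbolic X δ) {h : X → ℝ} {ξ : Boundary X} (hh : IsHorofunction h ξ) :
    ∃ D, ∀ (c : ℝ → X) (L : ℝ) (x y : X), IsGeodesic c L x y →
      ∃ τ ∈ Icc 0 L, ∀ t ∈ Icc 0 L, |h (c t) - (h (c τ) - |t - τ|)| ≤ D := by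
  obtain ⟨D, hD⟩ := hh (2 * δ + 1 + 2 * δ)
  refine ⟨D, fun c L x y hc => ?_⟩
  have hδ0 := hδ.nonneg x
  obtain ⟨a, ha0, ha⟩ := exists_ray hX hδ x ξ
  obtain ⟨b, hb0, hb⟩ := exists_ray hX hδ y ξ
  obtain ⟨τ, hτ, ⟨_, ⟨s, rfl⟩, hs⟩, _, ⟨s', rfl⟩, hs'⟩ := exists_near_both (r := 2 * δ)
    (A := range a.toFun) (B := range b.toFun) hc.nonneg hc.continuousOn
    ⟨x, ⟨0, ha0⟩, by simpa [hc.source] using hδ0⟩ ⟨y, ⟨0, hb0⟩, by simpa [hc.target] using hδ0⟩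
    (fun t ht => (ideal_slim_side hX hδ hc.segment ha0 hb0 (ha.trans hb.symm)
      ⟨t, ht, rfl⟩).imp (fun ⟨s, hs⟩ => ⟨_, ⟨s, rfl⟩, hs⟩) (fun ⟨s, hs⟩ => ⟨_, ⟨s, rfl⟩, hs⟩))
  refine ⟨τ, hτ, fun t ht => ?_⟩
  have key : IsCenter (2 * δ + 1 + 2 * δ) (c t) (c τ) ξ (c τ) := by
    rcases le_total t τ with h | h
    · exact ha ▸ isCenter_of_near_ray hX hδ hc ha0 hτ (by linarith) ⟨s, hs⟩ ⟨ht.1, h⟩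
    · have := isCenter_of_near_ray (τ := L - τ) (t := L - t) hX hδ hc.reverse hb0
        ⟨by linarith [hτ.2], by linarith [hτ.1]⟩ (r := 2 * δ + 1)
        (by linarith) ⟨s', by simpa using hs'⟩ ⟨by linarith [ht.2], by linarith⟩
      simpa [hb] using this
  have := hD _ _ _ key
  rw [hc.isometric t ht τ hτ, dist_self, add_zero] at this
  rwa [show h (c t) - (h (c τ) - |t - τ|) = h (c t) + |t - τ| - h (c τ) by ring]

/-- Move along a ray to `ξ`. The point reached is a `0`-center of the degenerate triangle it forms
with `x` and `ξ`. -/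
theorem IsHorofunction.exists_up [ProperSpace X] (hX : IsGeodesicSpace X)
    (hδ : IsDeltaHyperbolic X δ) {h : X → ℝ} {ξ : Boundary X} (hh : IsHorofunction h ξ) :
    ∃ D, ∀ (x : X) (s : ℝ), 0 ≤ s → ∃ y, dist x y ≤ s ∧ h x + s - D ≤ h y := by
  obtain ⟨D, hD⟩ := hh 0
  refine ⟨D, fun x s hs => ?_⟩
  lift s to ℝ≥0 using hs
  obtain ⟨a, ha0, ha⟩ := exists_ray hX hδ x ξ
  have hd : dist x (a.toFun s) = s := by
    have := a.dist_eq 0 s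
    simpa [ha0] using this
  refine ⟨a.toFun s, hd.le, ?_⟩
  have hS := ha0 ▸ a.segment s
  have := hD x (a.toFun s) (a.toFun s) ⟨_, a, a.shift s, hS, ha0, ha, by simp [GeodesicRay.shift],
    by rw [a.shift_endpoint, ha], ⟨_, hS.right_mem, by simp⟩, ⟨s, by simp⟩,
    ⟨0, by simp [GeodesicRay.shift]⟩⟩
  rw [hd, dist_self, add_zero] at this
  linarith [(abs_le.1 this).2]

theorem IsHoroball.exists_horoData [ProperSpace X] (hX : IsGeodesicSpace X)
    (hδ : IsDeltaHyperbolic X δ) {B : Set X} {ξ : Boundary X} (hB : IsHoroball B ξ) :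
    ∃ h D, HoroData B h D := by
  obtain ⟨h, D₁, hh, hmem, hnot⟩ := hB
  obtain ⟨D₂, hD₂⟩ := hh.exists_peak hX hδ
  obtain ⟨D₃, hD₃⟩ := hh.exists_up hX hδ
  have e1 := le_abs_self D₁
  have e2 := le_abs_self D₂
  have e3 := le_abs_self D₃
  have p1 := abs_nonneg D₁
  have p2 := abs_nonneg D₂
  have p3 := abs_nonneg D₃
  refine ⟨h, |D₁| + |D₂| + |D₃|, by positivity, fun x hx => by linarith [hmem x hx],
    fun x hx => by linarith [hnot x hx], fun c L x y hc => ?_, fun x s hs => ?_⟩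
  · obtain ⟨τ, hτ, H⟩ := hD₂ c L x y hc
    exact ⟨τ, hτ, fun t ht => (H t ht).trans (by linarith)⟩
  · obtain ⟨y, hy, hy'⟩ := hD₃ x s hs
    exact ⟨y, hy, by linarith⟩

namespace HoroData

variable {B : Set X} {h : X → ℝ} {D : ℝ}

theorem mono (H : HoroData B h D) {D' : ℝ} (hD : D ≤ D') : HoroData B h D' where
  nonneg := H.nonneg.trans hD
  of_mem x hx := by linarith [H.of_mem x hx]
  of_notMem x hx := by linarith [H.of_notMem x hx]
  peak c L x y hc := by
    obtain ⟨τ, hτ, h⟩ := H.peak c L x y hc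
    exact ⟨τ, hτ, fun t ht => (h t ht).trans hD⟩
  up x s hs := by
    obtain ⟨y, hy, hy'⟩ := H.up x s hs
    exact ⟨y, hy, by linarith⟩

theorem lipschitz (H : HoroData B h D) (hX : IsGeodesicSpace X) (x y : X) :
    h x ≤ h y + dist x y + 2 * D := by
  obtain ⟨S, c, L, hc, -⟩ := hX x y
  obtain ⟨τ, hτ, hp⟩ := H.peak c L x y hc
  have h0 := hp 0 ⟨le_rfl, hc.nonneg⟩
  have h1 := hp L ⟨hc.nonneg, le_rfl⟩
  rw [hc.source, zero_sub, abs_neg, abs_of_nonneg hτ.1] at h0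
  rw [hc.target, abs_of_nonneg (sub_nonneg.2 hτ.2)] at h1
  have h0 := (abs_le.1 h0).2
  have h1 := (abs_le.1 h1).1
  rw [hc.dist_eq]
  linarith [hτ.1]

theorem mem_of_lt (H : HoroData B h D) {x : X} (hx : D < h x) : x ∈ B := by
  by_contra hB
  linarith [H.of_notMem x hB]

/-- Endpoints of nearly equal height force the peak to be near the midpoint, so a long geodesic
between low points climbs to about half its length. -/
theorem le_midpoint (H : HoroData B h D) {c : ℝ → X} {L E : ℝ} {x y : X}
    (hc : IsGeodesic c L x y) (hx : |h x| ≤ E) (hy : |h y| ≤ E) :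
    L / 2 - 3 * E - 4 * D ≤ h (c (L / 2)) := by
  obtain ⟨τ, hτ, hp⟩ := H.peak c L x y hc
  have h0 := hp 0 ⟨le_rfl, hc.nonneg⟩
  have h1 := hp L ⟨hc.nonneg, le_rfl⟩
  have h2 := hp (L / 2) ⟨by linarith [hc.nonneg], by linarith [hc.nonneg]⟩
  rw [hc.source, zero_sub, abs_neg, abs_of_nonneg hτ.1] at h0
  rw [hc.target, abs_of_nonneg (sub_nonneg.2 hτ.2)] at h1
  rw [abs_le] at *
  have h3 : |L / 2 - τ| ≤ D + E := abs_le.2 ⟨by linarith, by linarith⟩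
  linarith

theorem le_half_length (H : HoroData B h D) {c : ℝ → X} {L E : ℝ} {x y : X}
    (hc : IsGeodesic c L x y) (hx : |h x| ≤ E) (hy : |h y| ≤ E) {t : ℝ} (ht : t ∈ Icc 0 L) :
    h (c t) ≤ L / 2 + E + 2 * D := by
  obtain ⟨τ, hτ, hp⟩ := H.peak c L x y hc
  have h0 := hp 0 ⟨le_rfl, hc.nonneg⟩
  have h1 := hp L ⟨hc.nonneg, le_rfl⟩
  have h2 := hp t ht
  rw [hc.source, zero_sub, abs_neg, abs_of_nonneg hτ.1] at h0
  rw [hc.target, abs_of_nonneg (sub_nonneg.2 hτ.2)] at h1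
  rw [abs_le] at *
  linarith [abs_nonneg (t - τ)]

/-- A point of a geodesic between two points that are not too low lies within about its own height
of one of them. -/
theorem dist_le_height (H : HoroData B h D) {c : ℝ → X} {L : ℝ} {x y : X}
    (hc : IsGeodesic c L x y) {t₁ t₂ t E : ℝ} (ht₁ : t₁ ∈ Icc 0 L) (ht₂ : t₂ ∈ Icc 0 L)
    (h₁ : t₁ ≤ t) (h₂ : t ≤ t₂) (hE₁ : -E ≤ h (c t₁)) (hE₂ : -E ≤ h (c t₂)) :
    t - t₁ ≤ h (c t) + E + 2 * D ∨ t₂ - t ≤ h (c t) + E + 2 * D := by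
  obtain ⟨τ, hτ, hp⟩ := H.peak c L x y hc
  have h0 := hp t₁ ht₁
  have h3 := hp t₂ ht₂
  have h4 := hp t ⟨ht₁.1.trans h₁, h₂.trans ht₂.2⟩
  rcases le_total t τ with h | h
  · left
    rw [abs_sub_comm t₁, abs_of_nonneg (by linarith : 0 ≤ τ - t₁)] at h0
    rw [abs_sub_comm t, abs_of_nonneg (by linarith : 0 ≤ τ - t)] at h4
    rw [abs_le] at *
    linarith
  · right
    rw [abs_of_nonneg (by linarith : 0 ≤ t₂ - τ)] at h3
    rw [abs_of_nonneg (by linarith : 0 ≤ t - τ)] at h4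
    rw [abs_le] at *
    linarith

/-- Concavity of `h` along geodesics. -/
theorem min_le (H : HoroData B h D) {c : ℝ → X} {L T : ℝ} {x y : X}
    (hc : IsGeodesic c L x y) (hx : T ≤ h x) (hy : T ≤ h y) {t : ℝ} (ht : t ∈ Icc 0 L) :
    T - 2 * D ≤ h (c t) := by
  obtain ⟨τ, hτ, hp⟩ := H.peak c L x y hc
  have h0 := hp 0 ⟨le_rfl, hc.nonneg⟩
  have h3 := hp L ⟨hc.nonneg, le_rfl⟩
  have h4 := hp t ht
  rw [hc.source, zero_sub, abs_neg, abs_of_nonneg hτ.1] at h0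
  rw [hc.target, abs_of_nonneg (sub_nonneg.2 hτ.2)] at h3
  rcases le_total t τ with h | h
  · rw [abs_sub_comm t, abs_of_nonneg (by linarith : 0 ≤ τ - t)] at h4
    rw [abs_le] at *
    linarith [ht.1]
  · rw [abs_of_nonneg (by linarith : 0 ≤ t - τ)] at h4
    rw [abs_le] at *
    linarith [ht.2]

/-- On a geodesic from `y` to a high point `z`, the position of a low point is determined by its
height and that of `y`. -/
theorem low_point_position (H : HoroData B h D) {c : ℝ → X} {L E : ℝ} {y z : X}
    (hc : IsGeodesic c L y z) (hz : E + 2 * D < h z) {t : ℝ} (ht : t ∈ Icc 0 L)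
    (hE : h (c t) ≤ E) : |h (c t) - (h y + t)| ≤ 2 * D := by
  obtain ⟨τ, hτ, hp⟩ := H.peak c L y z hc
  have h0 := hp 0 ⟨le_rfl, hc.nonneg⟩
  have h3 := hp L ⟨hc.nonneg, le_rfl⟩
  have h4 := hp t ht
  rw [hc.source, zero_sub, abs_neg, abs_of_nonneg hτ.1] at h0
  rw [hc.target, abs_of_nonneg (sub_nonneg.2 hτ.2)] at h3
  rcases le_total t τ with h | h
  · rw [abs_sub_comm t, abs_of_nonneg (by linarith : 0 ≤ τ - t)] at h4
    rw [abs_le] at *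
    constructor <;> linarith
  · exfalso
    rw [abs_of_nonneg (by linarith : 0 ≤ t - τ)] at h4
    rw [abs_le] at *
    linarith [ht.2]

/-- Two geodesics from `y` to high points enter the horoball near the same point. -/
theorem dist_low_points_le (H : HoroData B h D) (hX : IsGeodesicSpace X)
    (hδ : IsDeltaHyperbolic X δ) {S S' : Set X} {y z z' : X} {E : ℝ}
    (hS : IsGeodesicSegment S y z) (hS' : IsGeodesicSegment S' y z')
    (hz : E + δ + 6 * D + 1 < h z) (hz' : E + δ + 6 * D + 1 < h z') {p p' : X} (hp : p ∈ S)
    (hp' : p' ∈ S') (hE : |h p| ≤ E) (hE' : |h p'| ≤ E) :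
    dist p p' ≤ 2 * δ + 2 * E + 4 * D := by
  have hD := H.nonneg
  have hδ0 := hδ.nonneg y
  obtain ⟨T, hT⟩ := hX z z'
  obtain ⟨q, hq | hq, hpq⟩ := hδ y z z' S T S' hS hT hS' p hp
  · exfalso
    obtain ⟨c, L, hc, rfl⟩ := hT
    obtain ⟨t, ht, rfl⟩ := hq
    have h1 := H.min_le hc hz.le hz'.le ht
    have h2 := H.lipschitz hX (c t) p
    rw [dist_comm] at h2
    linarith [(abs_le.1 hE).2]
  · obtain ⟨c, L, hc, rfl⟩ := hS
    obtain ⟨c', L', hc', rfl⟩ := hS'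
    obtain ⟨t, ht, rfl⟩ := hp
    obtain ⟨t', ht', rfl⟩ := hp'
    obtain ⟨s, hs, rfl⟩ := hq
    have h1 := H.low_point_position hc (by linarith) ht (abs_le.1 hE).2
    have h2 := H.low_point_position hc' (by linarith) ht' (abs_le.1 hE').2
    have h3 := hc.dist_source ht
    have h4 := hc'.dist_source hs
    have h5 := dist_triangle y (c t) (c' s)
    have h6 := dist_triangle y (c' s) (c t)
    rw [dist_comm (c' s)] at h6
    have h7 := hc'.isometric s hs t' ht'
    have h8 := dist_triangle (c t) (c' s) (c' t')
    have h9 : |s - t'| ≤ δ + 2 * E + 4 * D := by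
      rw [abs_le] at *
      constructor <;> linarith
    linarith

end HoroData

end Horoballs

/-! ### Stabilizers of horoballs, maximal parabolic subgroups and local finiteness. -/

section Parabolics

theorem finite_dist_smul_le {G X : Type*} [Group G] [MetricSpace X] [MulAction G X]
    [ProperSpace X] [ProperlyDiscontinuousSMul G X] (x : X) (R : ℝ) :
    {g : G | dist x (g • x) ≤ R}.Finite := by
  refine (ProperlyDiscontinuousSMul.finite_disjoint_inter_image (Γ := G)
    (isCompact_singleton (x := x)) (isCompact_closedBall x R)).subset fun g hg => ?_
  refine ⟨g • x, ⟨x, rfl, rfl⟩, ?_⟩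
  rw [Metric.mem_closedBall, dist_comm]
  exact hg

theorem mem_smul_image {G X : Type*} [Group G] [MulAction G X] {g : G} {B : Set X} {x : X} :
    x ∈ (fun p => g • p) '' B ↔ g⁻¹ • x ∈ B := by
  constructor
  · rintro ⟨p, hp, rfl⟩
    simpa using hp
  · intro h
    exact ⟨_, h, by simp⟩

variable {G : Type*} {X : Type*} [Group G] [MetricSpace X] [MulAction G X] [IsIsometricSMul G X]
  {δ : ℝ}

theorem IsGeodesic.smul {c : ℝ → X} {L : ℝ} {x y : X} (hc : IsGeodesic c L x y) (g : G) :
    IsGeodesic (fun t => g • c t) L (g • x) (g • y) where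
  nonneg := hc.nonneg
  source := by rw [hc.source]
  target := by rw [hc.target]
  isometric s hs t ht := by rw [dist_smul, hc.isometric s hs t ht]

theorem IsGeodesicSegment.smul {S : Set X} {x y : X} (hS : IsGeodesicSegment S x y) (g : G) :
    IsGeodesicSegment ((fun p => g • p) '' S) (g • x) (g • y) := by
  obtain ⟨c, L, hc, rfl⟩ := hS
  exact ⟨_, L, hc.smul g, by rw [image_image]⟩

theorem HoroData.smul {B : Set X} {h : X → ℝ} {D : ℝ} (H : HoroData B h D) (g : G) :
    HoroData ((fun p => g • p) '' B) (fun x => h (g⁻¹ • x)) D where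
  nonneg := H.nonneg
  of_mem x hx := H.of_mem _ (mem_smul_image.1 hx)
  of_notMem x hx := H.of_notMem _ (fun h => hx (mem_smul_image.2 h))
  peak c L x y hc := H.peak _ L _ _ (hc.smul g⁻¹)
  up x s hs := by
    obtain ⟨y, hy, hy'⟩ := H.up (g⁻¹ • x) s hs
    refine ⟨g • y, ?_, by simpa using hy'⟩
    rwa [← dist_smul g⁻¹, inv_smul_smul]

/-- The heights of the images of a point outside `B` under isometries preserving `B` are
bounded. -/
theorem HoroData.exists_height_bound {B : Set X} {h : X → ℝ} {D : ℝ} (H : HoroData B h D)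
    (hX : IsGeodesicSpace X) {x : X} (hx : x ∉ B) :
    ∃ E, ∀ g : G, (∀ y, g • y ∈ B ↔ y ∈ B) → |h (g • x)| ≤ E := by
  have hD := H.nonneg
  have h1 := H.of_notMem x hx
  -- The upper bound comes from `g • x ∉ B`. For the lower one, climb from `x` to a point `y ∈ B`:
  -- the translate `g • y` stays in `B`, so it is not low, and `g • x` is at the same distance from
  -- it.
  obtain ⟨y, hy, hy'⟩ := H.up x (2 * D - h x + 1) (by linarith)
  have hyB : y ∈ B := H.mem_of_lt (by linarith)
  refine ⟨|h x| + 5 * D + 1, fun g hg => abs_le.2 ⟨?_, ?_⟩⟩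
  · have h2 := H.of_mem _ ((hg y).2 hyB)
    have h3 := H.lipschitz hX (g • y) (g • x)
    rw [dist_smul, dist_comm] at h3
    linarith [neg_abs_le (h x)]
  · linarith [H.of_notMem _ (fun h => hx ((hg x).1 h)), abs_nonneg (h x)]

theorem exists_linear_lt_two_pow (A C c : ℝ) (hc : 0 < c) : ∃ j : ℕ, A + C * j < c * 2 ^ j := by
  obtain ⟨i, hi⟩ := exists_nat_gt ((|A| + 2 * |C|) / c)
  rw [div_lt_iff₀ hc] at hi
  refine ⟨2 * i, ?_⟩
  have h1 : (i : ℝ) + 1 ≤ 2 ^ i := by exact_mod_cast Nat.lt_two_pow_self (n := i)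
  have h0 : (0 : ℝ) ≤ i := Nat.cast_nonneg i
  have h2 : ((i : ℝ) + 1) * (i + 1) ≤ 2 ^ (2 * i) := by
    rw [two_mul, pow_add]
    gcongr
  have h3 : c * ((i : ℝ) + 1) * (i + 1) ≤ c * 2 ^ (2 * i) := by
    rw [mul_assoc]; gcongr
  have h4 : (|A| + 2 * |C|) * ((i : ℝ) + 1) < c * ((i : ℝ) + 1) * (i + 1) := by
    apply mul_lt_mul_of_pos_right _ (by positivity)
    linarith
  have h5 : C * i ≤ |C| * i := mul_le_mul_of_nonneg_right (le_abs_self C) h0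
  have h6 : 0 ≤ |A| * i := by positivity
  push_cast
  linarith [le_abs_self A, abs_nonneg C]

/-- Distances along the orbit of `g` grow logarithmically: doubling the exponent adds only a
constant to the displacement, which is incompatible with linear growth. -/
theorem HoroData.not_isLoxodromic {B : Set X} {h : X → ℝ} {D : ℝ} (H : HoroData B h D)
    (hX : IsGeodesicSpace X) (hδ : IsDeltaHyperbolic X δ) {x : X} (hx : x ∉ B) {g : G}
    (hg : ∀ y, g • y ∈ B ↔ y ∈ B) : ¬ IsLoxodromic X g := by
  rintro ⟨c, hc, hlox⟩
  obtain ⟨E, hE⟩ := H.exists_height_bound (G := G) hX hx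
  have hpow : ∀ n : ℕ, ∀ y, g ^ n • y ∈ B ↔ y ∈ B := fun n => by
    induction n with
    | zero => simp
    | succ n ih => intro y; rw [pow_succ, mul_smul, ih, hg]
  have hEn := fun n => hE _ (hpow n)
  have hE0 : |h x| ≤ E := by simpa using hEn 0
  set C := 2 * (4 * E + 8 * D + δ)
  have hdouble : ∀ n : ℕ, dist x (g ^ (2 * n) • x) ≤ dist x (g ^ n • x) + C := fun n => by
    obtain ⟨S₀, c₀, L₀, hc₀, -⟩ := hX x (g ^ (2 * n) • x)
    obtain ⟨S₁, c₁, L₁, hc₁, -⟩ := hX x (g ^ n • x)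
    have hc₂ := hc₁.smul (g ^ n)
    rw [← mul_smul, ← pow_add, ← two_mul] at hc₂
    -- The midpoint of the long side has height about `L₀ / 2` and is near one of the two sides of
    -- length `L₁`, whose heights are at most about `L₁ / 2`.
    have hm := H.le_midpoint hc₀ hE0 (hEn _)
    obtain ⟨q, hq, hd⟩ := hδ _ _ _ _ _ _ hc₀.segment hc₂.reverse.segment hc₁.segment
      (c₀ (L₀ / 2)) ⟨L₀ / 2, ⟨by linarith [hc₀.nonneg], by linarith [hc₀.nonneg]⟩, rfl⟩
    have hq' : h q ≤ L₁ / 2 + E + 2 * D := by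
      rcases hq with ⟨t, ht, rfl⟩ | ⟨t, ht, rfl⟩
      · exact H.le_half_length hc₂.reverse (hEn _) (hEn _) ht
      · exact H.le_half_length hc₁ hE0 (hEn _) ht
    have hl := H.lipschitz hX (c₀ (L₀ / 2)) q
    rw [hc₀.dist_eq, hc₁.dist_eq]
    simp only [C]
    linarith
  have hlin : ∀ j : ℕ, dist x (g ^ (2 ^ j) • x) ≤ dist x (g • x) + C * j := fun j => by
    induction j with
    | zero => simp
    | succ j ih =>
      have := hdouble (2 ^ j)
      rw [← pow_succ'] at this
      push_cast
      linarith
  obtain ⟨j, hj⟩ := exists_linear_lt_two_pow (dist x (g • x)) C c hc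
  have := hlox x (2 ^ j)
  push_cast at this
  linarith [hlin j]

/-- An infinite group of isometries cannot preserve two disjoint horoballs. -/
theorem HoroData.not_disjoint_of_infinite [ProperSpace X] [ProperlyDiscontinuousSMul G X]
    (hX : IsGeodesicSpace X) {B B' : Set X} {h h' : X → ℝ} {D D' : ℝ} (H : HoroData B h D)
    (H' : HoroData B' h' D') {x : X} (hx : x ∉ B) (hx' : x ∉ B') {P : Set G} (hP : P.Infinite)
    (hg : ∀ g ∈ P, ∀ y, g • y ∈ B ↔ y ∈ B) (hg' : ∀ g ∈ P, ∀ y, g • y ∈ B' ↔ y ∈ B') :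
    ¬ Disjoint B B' := by
  obtain ⟨E, hE⟩ := H.exists_height_bound (G := G) hX hx
  obtain ⟨E', hE'⟩ := H'.exists_height_bound (G := G) hX hx'
  -- A displacement above `R` puts the midpoint at a height above `D` and `D'`, hence in both
  -- horoballs.
  set R := max (2 * (3 * E + 5 * D)) (2 * (3 * E' + 5 * D'))
  obtain ⟨g, hgP, hgR⟩ := hP.exists_notMem_finite (finite_dist_smul_le (G := G) x R)
  obtain ⟨S, c, L, hc, -⟩ := hX x (g • x)
  have hL : R < L := by
    rw [← hc.dist_eq]
    exact not_le.1 hgR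
  have h1 := H.le_midpoint hc (by simpa using hE 1 (by simp)) (hE g (hg g hgP))
  have h2 := H'.le_midpoint hc (by simpa using hE' 1 (by simp)) (hE' g (hg' g hgP))
  have l1 := le_max_left (2 * (3 * E + 5 * D)) (2 * (3 * E' + 5 * D'))
  have l2 := le_max_right (2 * (3 * E + 5 * D)) (2 * (3 * E' + 5 * D'))
  exact Set.not_disjoint_iff.2 ⟨c (L / 2), H.mem_of_lt (by linarith), H'.mem_of_lt (by linarith)⟩

theorem IsLoxodromic.conj {g : G} (k : G) (h : IsLoxodromic X (k⁻¹ * g * k)) :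
    IsLoxodromic X g := by
  obtain ⟨c, hc, H⟩ := h
  refine ⟨c, hc, fun x n => ?_⟩
  have := H (k⁻¹ • x) n
  have e : (k⁻¹ * g * k) ^ n = k⁻¹ * g ^ n * k := by
    simpa using conj_pow (a := k⁻¹) (b := g) (i := n)
  rwa [e, mul_smul, mul_smul, smul_inv_smul, dist_smul] at this

theorem IsParabolicAt.map_conj {P : Subgroup G} {ξ : Boundary X} (h : IsParabolicAt P ξ) (g : G) :
    IsParabolicAt (P.map (MulAut.conj g).toMonoidHom) (g • ξ) := by
  obtain ⟨h1, h2, h3⟩ := h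
  refine ⟨?_, ?_, ?_⟩
  · rw [Subgroup.coe_map]
    exact h1.image (MulAut.conj g).injective.injOn
  · rintro _ ⟨p, hp, rfl⟩ hl
    refine h2 p hp (IsLoxodromic.conj g⁻¹ ?_)
    simpa using hl
  · rintro _ ⟨p, hp, rfl⟩
    simp [mul_smul, h3 p hp]

theorem IsParabolicPoint.smul {ξ : Boundary X} (h : IsParabolicPoint G ξ) (g : G) :
    IsParabolicPoint G (g • ξ) := by
  obtain ⟨P, hP⟩ := h
  exact ⟨_, hP.map_conj g⟩

namespace IsRelHypAction

variable [ProperSpace X] [ProperlyDiscontinuousSMul G X] {Par : Set (Subgroup G)}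
  {B : Boundary X → Set X}

theorem smul_mem_iff (hG : IsRelHypAction G X Par B) {ξ : Boundary X}
    (hξ : IsParabolicPoint G ξ) (g : G) (x : X) : g • x ∈ B (g • ξ) ↔ x ∈ B ξ := by
  rw [hG.equivariant g ξ hξ, mem_smul_image, inv_smul_smul]

theorem smul_mem_iff_of_fixes (hG : IsRelHypAction G X Par B) {ξ : Boundary X}
    (hξ : IsParabolicPoint G ξ) {g : G} (hg : g • ξ = ξ) (x : X) : g • x ∈ B ξ ↔ x ∈ B ξ := by
  conv_lhs => rw [← hg]
  exact hG.smul_mem_iff hξ g x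

theorem smul_mem_horoballUnion (hG : IsRelHypAction G X Par B) (g : G) (x : X) :
    g • x ∈ horoballUnion G B ↔ x ∈ horoballUnion G B := by
  constructor
  · rintro ⟨ξ, hξ, hx⟩
    refine ⟨g⁻¹ • ξ, hξ.smul g⁻¹, ?_⟩
    rwa [← hG.smul_mem_iff (hξ.smul g⁻¹) g, smul_inv_smul]
  · rintro ⟨ξ, hξ, hx⟩
    exact ⟨g • ξ, hξ.smul g, (hG.smul_mem_iff hξ g x).2 hx⟩

theorem exists_horoData (hG : IsRelHypAction G X Par B) {ξ : Boundary X}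
    (hξ : IsParabolicPoint G ξ) : ∃ h D, HoroData (B ξ) h D := by
  obtain ⟨δ, hδ⟩ := hG.hyperbolic
  exact (hG.horoball ξ hξ).exists_horoData hG.geodesic hδ

theorem eq_of_infinite_fixes (hG : IsRelHypAction G X Par B) {x₀ : X}
    (hx₀ : x₀ ∉ horoballUnion G B) {ξ η : Boundary X} (hξ : IsParabolicPoint G ξ)
    (hη : IsParabolicPoint G η) {P : Set G} (hP : P.Infinite) (h : ∀ g ∈ P, g • ξ = ξ)
    (h' : ∀ g ∈ P, g • η = η) : ξ = η := by
  by_contra hne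
  obtain ⟨f, D, H⟩ := hG.exists_horoData hξ
  obtain ⟨f', D', H'⟩ := hG.exists_horoData hη
  exact H.not_disjoint_of_infinite hG.geodesic H' (fun hx => hx₀ ⟨ξ, hξ, hx⟩)
    (fun hx => hx₀ ⟨η, hη, hx⟩) hP (fun g hg => hG.smul_mem_iff_of_fixes hξ (h g hg))
    (fun g hg => hG.smul_mem_iff_of_fixes hη (h' g hg)) (hG.disjoint ξ η hξ hη hne)

theorem isParabolicAt_stabilizer (hG : IsRelHypAction G X Par B) {x₀ : X}
    (hx₀ : x₀ ∉ horoballUnion G B) {ξ : Boundary X} (hξ : IsParabolicPoint G ξ) :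
    IsParabolicAt (MulAction.stabilizer G ξ) ξ := by
  obtain ⟨δ, hδ⟩ := hG.hyperbolic
  obtain ⟨h, D, H⟩ := hG.exists_horoData hξ
  refine ⟨?_, fun g hg => ?_, fun g hg => hg⟩
  · obtain ⟨P, hP⟩ := hξ
    exact hP.1.mono hP.2.2
  · exact H.not_isLoxodromic hG.geodesic hδ (fun hx => hx₀ ⟨ξ, hξ, hx⟩)
      (hG.smul_mem_iff_of_fixes hξ hg)

/-- A parabolic subgroup containing the stabilizer fixes some `η`. The stabilizer is infinite and
fixes both `ξ` and `η`, so these coincide. -/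
theorem isMaximalParabolic_stabilizer (hG : IsRelHypAction G X Par B) {x₀ : X}
    (hx₀ : x₀ ∉ horoballUnion G B) {ξ : Boundary X} (hξ : IsParabolicPoint G ξ) :
    IsMaximalParabolic X (MulAction.stabilizer G ξ) := by
  have hs := hG.isParabolicAt_stabilizer hx₀ hξ
  refine ⟨⟨ξ, hs⟩, ?_⟩
  rintro P ⟨η, hP⟩ hle g hg
  have := hG.eq_of_infinite_fixes hx₀ hξ ⟨P, hP⟩ hs.1 hs.2.2 (fun k hk => hP.2.2 k (hle hk))
  subst this
  exact hP.2.2 g hg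

/-- Parabolic points fall into finitely many orbits. -/
theorem exists_finite_orbit_representatives (hG : IsRelHypAction G X Par B) {x₀ : X}
    (hx₀ : x₀ ∉ horoballUnion G B) : ∃ F : Set (Boundary X), F.Finite ∧
      (∀ ξ ∈ F, IsParabolicPoint G ξ) ∧
      ∀ ξ, IsParabolicPoint G ξ → ∃ ζ ∈ F, ∃ g : G, g • ζ = ξ := by
  have hex : ∀ P : Par, ∃ ζ : Boundary X, IsParabolicAt (P : Subgroup G) ζ :=
    fun P => (hG.maximalParabolic P P.2).prop
  choose ζ hζ using hex
  have := hG.finite.to_subtype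
  refine ⟨range ζ, finite_range ζ, ?_, fun ξ hξ => ?_⟩
  · rintro _ ⟨P, rfl⟩
    exact ⟨P, hζ P⟩
  · obtain ⟨P, ⟨hP, g, hg⟩, -⟩ :=
      hG.representative _ (hG.isMaximalParabolic_stabilizer hx₀ hξ)
    refine ⟨ζ ⟨P, hP⟩, ⟨_, rfl⟩, g, ?_⟩
    have hpar := (hζ ⟨P, hP⟩).map_conj g
    rw [← hg] at hpar
    exact hG.eq_of_infinite_fixes hx₀ ⟨_, hpar⟩ hξ hpar.1 hpar.2.2 fun k hk => hk

/-- There are finitely many orbits of horoballs, and translation preserves the constant. -/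
theorem exists_uniform_horoData (hG : IsRelHypAction G X Par B) {x₀ : X}
    (hx₀ : x₀ ∉ horoballUnion G B) :
    ∃ D, 0 ≤ D ∧ ∀ ξ, IsParabolicPoint G ξ → ∃ h, HoroData (B ξ) h D := by
  obtain ⟨F, hF, hFp, hFo⟩ := hG.exists_finite_orbit_representatives hx₀
  have hex : ∀ ζ : F, ∃ D h, HoroData (B ζ) h D := fun ζ => by
    obtain ⟨h, D, H⟩ := hG.exists_horoData (hFp ζ ζ.2)
    exact ⟨D, h, H⟩
  choose D h H using hex
  have := hF.to_subtype
  obtain ⟨M, hM⟩ := (finite_range D).bddAbove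
  refine ⟨max M 0, le_max_right _ _, fun ξ hξ => ?_⟩
  obtain ⟨ζ, hζ, g, rfl⟩ := hFo ξ hξ
  rw [hG.equivariant g ζ (hFp ζ hζ)]
  exact ⟨_, ((H ⟨ζ, hζ⟩).smul g).mono ((hM ⟨⟨ζ, hζ⟩, rfl⟩).trans (le_max_left _ _))⟩

/-- The horoballs form a locally finite collection. -/
theorem finite_near (hG : IsRelHypAction G X Par B) {x₀ : X}
    (hx₀ : x₀ ∉ horoballUnion G B) (r : ℝ) :
    {ξ | IsParabolicPoint G ξ ∧ ∃ y ∈ B ξ, dist x₀ y ≤ r}.Finite := by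
  obtain ⟨D, hD, hH⟩ := hG.exists_uniform_horoData hx₀
  -- Climbing by `s` from a point of the horoball reaches a point whose closed unit ball lies in the
  -- horoball. Disjointness makes these points more than `1` apart, and they all lie in a compact
  -- ball.
  set s := 5 * D + 2
  have hball : ∀ ξ, (IsParabolicPoint G ξ ∧ ∃ y ∈ B ξ, dist x₀ y ≤ r) →
      ∃ z ∈ Metric.closedBall x₀ (r + s), ∀ w, dist z w ≤ 1 → w ∈ B ξ := by
    rintro ξ ⟨hξ, y, hy, hd⟩
    obtain ⟨h, H⟩ := hH ξ hξ
    obtain ⟨z, hz, hz'⟩ := H.up y s (by positivity)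
    refine ⟨z, ?_, fun w hw => H.mem_of_lt ?_⟩
    · rw [Metric.mem_closedBall, dist_comm]
      linarith [dist_triangle x₀ y z]
    · have := H.lipschitz hG.geodesic z w
      have := H.of_mem y hy
      simp only [s] at hz'
      linarith
  have : Nonempty X := ⟨x₀⟩
  choose! z hz hzB using hball
  obtain ⟨T, -, hT, hcov⟩ := finite_cover_balls_of_compact
    (isCompact_closedBall x₀ (r + s)) (e := 1 / 2) (by norm_num)
  have hex : ∀ ξ, (IsParabolicPoint G ξ ∧ ∃ y ∈ B ξ, dist x₀ y ≤ r) →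
      ∃ t ∈ T, dist (z ξ) t < 1 / 2 := fun ξ hξ => by
    simpa using hcov (hz ξ hξ)
  choose! t ht htd using hex
  refine Set.Finite.of_injOn (f := t) (t := T) ht ?_ hT
  intro ξ hξ η hη heq
  by_contra hne
  refine Set.disjoint_left.1 (hG.disjoint ξ η hξ.1 hη.1 hne)
    (hzB ξ hξ (z η) ?_) (hzB η hη (z η) (by simp))
  have h1 := htd ξ hξ
  have h2 := htd η hη
  rw [← heq, dist_comm] at h2
  linarith [dist_triangle (z ξ) (t ξ) (z η)]

end IsRelHypAction

end Parabolics

/-! ### Finiteness arguments for orbits, and exits from horoballs. -/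

section Quasiconvex

variable {G : Type*} {X : Type*} [Group G] [MetricSpace X] [MulAction G X] [IsIsometricSMul G X]
  {δ : ℝ}

theorem exists_uniform_bound {α : Type*} {s : Set α} (hs : s.Finite) {p : α → ℝ → Prop}
    (mono : ∀ a C C', C ≤ C' → p a C → p a C') (h : ∀ a ∈ s, ∃ C, p a C) :
    ∃ C, ∀ a ∈ s, p a C := by
  choose! C hC using h
  obtain ⟨M, hM⟩ := (hs.image C).bddAbove
  exact ⟨M, fun a ha => mono a _ _ (hM ⟨a, ha, rfl⟩) (hC a ha)⟩

variable [ProperSpace X] [ProperlyDiscontinuousSMul G X] {Par : Set (Subgroup G)}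
  {B : Boundary X → Set X}

/-- Neighbourhoods of two orbits meet only near the orbit of the intersection. -/
theorem exists_near_inf (Q R : Subgroup G) (x₀ : X) (c : ℝ) :
    ∃ C, ∀ q ∈ Q, ∀ r ∈ R, dist (q • x₀) (r • x₀) ≤ c →
      ∃ h ∈ Q ⊓ R, dist (q • x₀) (h • x₀) ≤ C := by
  obtain ⟨C, hC⟩ := exists_uniform_bound (finite_dist_smul_le (G := G) x₀ c)
    (p := fun g C => ∀ q ∈ Q, ∀ r ∈ R, q⁻¹ * r = g →
      ∃ h ∈ Q ⊓ R, dist (q • x₀) (h • x₀) ≤ C)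
    (fun g C C' hC hp q hq r hr e => by
      obtain ⟨h, hh, hd⟩ := hp q hq r hr e
      exact ⟨h, hh, hd.trans hC⟩)
    (fun g _ => by
      by_cases hex : ∃ q ∈ Q, ∃ r ∈ R, q⁻¹ * r = g
      · obtain ⟨q₀, hq₀, r₀, hr₀, e₀⟩ := hex
        -- Only finitely many values `g` of `q⁻¹ * r` occur. Comparing with a fixed pair of the same
        -- value gives `q * q₀⁻¹ = r * r₀⁻¹`, an element of both subgroups.
        refine ⟨dist x₀ (q₀⁻¹ • x₀), fun q hq r hr e => ⟨q * q₀⁻¹, ⟨?_, ?_⟩, ?_⟩⟩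
        · exact Q.mul_mem hq (Q.inv_mem hq₀)
        · have : q * q₀⁻¹ = r * r₀⁻¹ := by
            have hr' : r = q * g := by rw [← e]; group
            have hr₀' : r₀ = q₀ * g := by rw [← e₀]; group
            rw [hr', hr₀']; group
          rw [this]
          exact R.mul_mem hr (R.inv_mem hr₀)
        · rw [mul_smul, dist_smul]
      · exact ⟨0, fun q hq r hr e => (hex ⟨q, hq, r, hr, e⟩).elim⟩)
  refine ⟨C, fun q hq r hr hd => hC (q⁻¹ * r) ?_ q hq r hr rfl⟩
  rwa [mem_ofPred_eq, mul_smul, ← dist_smul q, smul_inv_smul]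

namespace IsRelHypAction

/-- Orbit points of a subgroup near a horoball are near the orbit of the stabilizer of its
center. -/
theorem exists_near_stabilizer (hG : IsRelHypAction G X Par B) {x₀ : X}
    (hx₀ : x₀ ∉ horoballUnion G B) (Q : Subgroup G) (c : ℝ) :
    ∃ C, ∀ ξ, IsParabolicPoint G ξ → (∃ y ∈ B ξ, dist x₀ y ≤ c) → ∀ k ∈ Q,
      (∃ y ∈ B ξ, dist (k • x₀) y ≤ c) →
        ∃ p ∈ Q, p • ξ = ξ ∧ dist (k • x₀) (p • x₀) ≤ C := by
  have hF := hG.finite_near hx₀ c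
  obtain ⟨C, hC⟩ := exists_uniform_bound (hF.prod hF)
    (p := fun a C => ∀ k ∈ Q, k • a.2 = a.1 →
      ∃ p ∈ Q, p • a.1 = a.1 ∧ dist (k • x₀) (p • x₀) ≤ C)
    (fun a C C' hC hp k hk e => by
      obtain ⟨p, hp, e', hd⟩ := hp k hk e
      exact ⟨p, hp, e', hd.trans hC⟩)
    (fun a _ => by
      by_cases hex : ∃ k ∈ Q, k • a.2 = a.1
      · obtain ⟨k₀, hk₀, e₀⟩ := hex
        -- Only finitely many pairs `(ξ, k⁻¹ • ξ)` occur; two elements with the same pair differ by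
        -- an element fixing `ξ`.
        refine ⟨dist x₀ (k₀⁻¹ • x₀), fun k hk e => ⟨k * k₀⁻¹, Q.mul_mem hk (Q.inv_mem hk₀), ?_, ?_⟩⟩
        · rw [← e₀, mul_smul, inv_smul_smul, e, e₀]
        · rw [mul_smul, dist_smul]
      · exact ⟨0, fun k hk e => (hex ⟨k, hk, e⟩).elim⟩)
  refine ⟨C, fun ξ hξ hy k hk hky => hC (ξ, k⁻¹ • ξ) ⟨⟨hξ, hy⟩, hξ.smul _, ?_⟩ k hk (by simp)⟩
  obtain ⟨y, hyB, hd⟩ := hky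
  exact ⟨k⁻¹ • y, (hG.smul_mem_iff hξ _ _).2 hyB, by rwa [← dist_smul k, smul_inv_smul]⟩

/-- A geodesic leaves a horoball through a point outside all horoballs. -/
theorem exists_exit (hG : IsRelHypAction G X Par B) {c : ℝ → X} {L : ℝ} {x y : X}
    (hc : IsGeodesic c L x y) (hy : y ∉ horoballUnion G B) {ξ : Boundary X}
    (hξ : IsParabolicPoint G ξ) {t : ℝ} (ht : t ∈ Icc 0 L) (htB : c t ∈ B ξ) :
    ∃ t' ∈ Icc t L, c t' ∉ horoballUnion G B ∧ ∃ b ∈ B ξ, dist (c t') b ≤ 1 := by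
  have hcont : ContinuousOn c (Icc t L) := hc.continuousOn.mono (Icc_subset_Icc_left ht.1)
  have hcl : IsClosed (Icc t L ∩ c ⁻¹' (B ξ)ᶜ) :=
    hcont.preimage_isClosed_of_isClosed isClosed_Icc (hG.isOpen ξ hξ).isClosed_compl
  have hcpt : IsCompact (Icc t L ∩ c ⁻¹' (B ξ)ᶜ) :=
    isCompact_Icc.of_isClosed_subset hcl inter_subset_left
  obtain ⟨t', ⟨ht', htB'⟩, hleast⟩ := hcpt.exists_isLeast
    ⟨L, ⟨ht.2, le_rfl⟩, fun h => hy ⟨ξ, hξ, by rwa [hc.target] at h⟩⟩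
  have hlt : t < t' := lt_of_le_of_ne ht'.1 (by rintro rfl; exact htB' htB)
  have hin : ∀ s, t ≤ s → s < t' → c s ∈ B ξ := fun s hs hs' => by
    by_contra hB
    exact absurd (hleast ⟨⟨hs, hs'.le.trans ht'.2⟩, hB⟩) (not_le.2 hs')
  have hdist : ∀ s, t ≤ s → s < t' → dist (c t') (c s) = t' - s := fun s hs hs' => by
    rw [hc.isometric t' ⟨ht.1.trans ht'.1, ht'.2⟩ s ⟨ht.1.trans hs, hs'.le.trans ht'.2⟩,
      abs_of_pos (sub_pos.2 hs')]
  have hnear : ∀ ε > 0, ∃ b ∈ B ξ, dist b (c t') < ε := fun ε hε => by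
    have h1 : t ≤ max t (t' - ε / 2) := le_max_left _ _
    have h2 : max t (t' - ε / 2) < t' := max_lt hlt (by linarith)
    refine ⟨_, hin _ h1 h2, ?_⟩
    rw [dist_comm, hdist _ h1 h2]
    linarith [le_max_right t (t' - ε / 2)]
  refine ⟨t', ht', ?_, ?_⟩
  -- At the first exit time the point has left `B ξ`. Another open horoball containing it would also
  -- contain slightly earlier points, which lie in `B ξ`.
  · rintro ⟨η, hη, hηB⟩
    have hne : ξ ≠ η := by
      rintro rfl
      exact htB' hηB
    obtain ⟨ε, hε, hball⟩ := Metric.isOpen_iff.1 (hG.isOpen η hη) _ hηB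
    obtain ⟨b, hb, hd⟩ := hnear ε hε
    exact Set.disjoint_left.1 (hG.disjoint ξ η hξ hη hne) hb (hball hd)
  · obtain ⟨b, hb, hd⟩ := hnear 1 one_pos
    exact ⟨b, hb, by rw [dist_comm]; exact hd.le⟩

theorem exists_exit_segment (hG : IsRelHypAction G X Par B) {S : Set X} {x y : X}
    (hS : IsGeodesicSegment S x y) (hy : y ∉ horoballUnion G B) {ξ : Boundary X}
    (hξ : IsParabolicPoint G ξ) {p : X} (hp : p ∈ S) (hpB : p ∈ B ξ) :
    ∃ T ⊆ S, IsGeodesicSegment T p y ∧ ∃ u ∈ T, u ∉ horoballUnion G B ∧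
      ∃ b ∈ B ξ, dist u b ≤ 1 := by
  obtain ⟨c, L, hc, rfl⟩ := hS
  obtain ⟨t, ht, rfl⟩ := hp
  obtain ⟨t', ht', h⟩ := hG.exists_exit hc hy hξ ht hpB
  refine ⟨c '' Icc t L, image_mono (Icc_subset_Icc_left ht.1), ?_, c t', ⟨t', ht', rfl⟩, h⟩
  have := hc.segment_sub ht.1 ht.2 le_rfl
  rwa [hc.target] at this

variable {D : ℝ} {f : Boundary X → X → ℝ}

theorem abs_height_le (hG : IsRelHypAction G X Par B) {ξ : Boundary X}
    (hξ : IsParabolicPoint G ξ) {h : X → ℝ} (H : HoroData (B ξ) h D) {u : X}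
    (hu : u ∉ horoballUnion G B) (hb : ∃ b ∈ B ξ, dist u b ≤ 1) : |h u| ≤ 3 * D + 1 := by
  have hD := H.nonneg
  obtain ⟨b, hb, hd⟩ := hb
  have h1 := H.of_mem b hb
  have h2 := H.of_notMem u (fun h => hu ⟨ξ, hξ, h⟩)
  have h3 := H.lipschitz hG.geodesic b u
  rw [dist_comm] at h3
  exact abs_le.2 ⟨by linarith, by linarith⟩

/-- A point of low height on a geodesic is near a point of the geodesic outside all horoballs. -/
theorem exists_near_notMem (hG : IsRelHypAction G X Par B) (hD : 0 ≤ D)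
    (H : ∀ ξ, IsParabolicPoint G ξ → HoroData (B ξ) (f ξ) D) {S : Set X} {x y : X}
    (hS : IsGeodesicSegment S x y) (hx : x ∉ horoballUnion G B) (hy : y ∉ horoballUnion G B)
    {p : X} (hp : p ∈ S) {K : ℝ} (hK : 0 ≤ K)
    (h : ∀ ξ, IsParabolicPoint G ξ → p ∈ B ξ → f ξ p ≤ K) :
    ∃ u ∈ S, u ∉ horoballUnion G B ∧ dist p u ≤ K + 5 * D + 1 := by
  by_cases hpU : p ∈ horoballUnion G B
  · obtain ⟨ξ, hξ, hpB⟩ := hpU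
    have Hξ := H ξ hξ
    have hfp := h ξ hξ hpB
    obtain ⟨c, L, hc, rfl⟩ := hS
    obtain ⟨t, ht, rfl⟩ := hp
    obtain ⟨t₂, ht₂, hu₂, hb₂⟩ := hG.exists_exit hc hy hξ ht hpB
    obtain ⟨t₁, ht₁, hu₁, hb₁⟩ := hG.exists_exit hc.reverse hx hξ
      (t := L - t) ⟨by linarith [ht.2], by linarith [ht.1]⟩ (by simpa using hpB)
    have e₁ := (abs_le.1 (hG.abs_height_le hξ Hξ hu₁ hb₁)).1
    have e₂ := (abs_le.1 (hG.abs_height_le hξ Hξ hu₂ hb₂)).1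
    have m₁ : L - t₁ ∈ Icc 0 L := ⟨by linarith [ht₁.2], by linarith [ht₁.1, ht.2]⟩
    have m₂ : t₂ ∈ Icc 0 L := ⟨by linarith [ht₂.1, ht.1], ht₂.2⟩
    -- Both exits have height at least `-(3 * D + 1)`, so the point is within about its own height,
    -- at most `K`, of one of them.
    rcases Hξ.dist_le_height hc m₁ m₂ (by linarith [ht₁.1]) ht₂.1 e₁ e₂ with h' | h'
    · refine ⟨_, ⟨_, m₁, rfl⟩, hu₁, ?_⟩
      rw [hc.isometric t ht _ m₁, abs_of_nonneg (by linarith [ht₁.1])]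
      linarith
    · refine ⟨_, ⟨_, m₂, rfl⟩, hu₂, ?_⟩
      rw [hc.isometric t ht _ m₂, abs_sub_comm, abs_of_nonneg (by linarith [ht₂.1])]
      linarith
  · refine ⟨p, hp, hpU, ?_⟩
    rw [dist_self]
    positivity

end IsRelHypAction
end Quasiconvex

/-! ### Geodesics between the two orbits pass near the orbit of the intersection. -/

section Key

variable {G : Type*} {X : Type*} [Group G] [MetricSpace X] [MulAction G X] [IsIsometricSMul G X]
  {δ : ℝ} [ProperSpace X] [ProperlyDiscontinuousSMul G X] {Par : Set (Subgroup G)}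
  {B : Boundary X → Set X} {D : ℝ} {f : Boundary X → X → ℝ}

namespace IsRelHypAction

/-- Two geodesics from a point outside the horoballs to high points of the same horoball enter it
near the same point. -/
theorem exists_common_entry (hG : IsRelHypAction G X Par B) (hδ : IsDeltaHyperbolic X δ)
    {ξ : Boundary X} (hξ : IsParabolicPoint G ξ) {h : X → ℝ} (H : HoroData (B ξ) h D)
    {S S' : Set X} {y z z' p p' : X} (hy : y ∉ horoballUnion G B)
    (hS : IsGeodesicSegment S y z) (hS' : IsGeodesicSegment S' y z') (hp : p ∈ S) (hp' : p' ∈ S')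
    (hhp : 9 * D + δ + 2 < h p) (hhp' : 9 * D + δ + 2 < h p') :
    ∃ u ∈ S, ∃ u' ∈ S', u ∉ horoballUnion G B ∧ u' ∉ horoballUnion G B ∧
      (∃ b ∈ B ξ, dist u b ≤ 1) ∧ dist u u' ≤ 2 * δ + 10 * D + 2 := by
  have hD := H.nonneg
  have hδ0 := hδ.nonneg y
  obtain ⟨T, hTS, hT, u, hu, huU, hub⟩ :=
    hG.exists_exit_segment hS.symm hy hξ hp (H.mem_of_lt (by linarith))
  obtain ⟨T', hTS', hT', u', hu', huU', hub'⟩ :=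
    hG.exists_exit_segment hS'.symm hy hξ hp' (H.mem_of_lt (by linarith))
  refine ⟨u, hTS hu, u', hTS' hu', huU, huU', hub, ?_⟩
  -- Entry points have height at most `E = 3 * D + 1` in absolute value; the threshold `9 * D + δ +
  -- 2` is `E + δ + 6 * D + 1`.
  have := H.dist_low_points_le hG.geodesic hδ hT.symm hT'.symm (E := 3 * D + 1)
    (by linarith) (by linarith) hu hu' (hG.abs_height_le hξ H huU hub)
    (hG.abs_height_le hξ H huU' hub')
  linarith

/-- The two sides at the corner `q • x₀` enter the horoball near a common point, which
quasiconvexity places near the orbit of `Q`. Translating by `h⁻¹` brings the horoball near `x₀`,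
where `exists_near_stabilizer` replaces the orbit point by one from the stabilizer. -/
theorem exists_near_stabilizer_of_deep (hG : IsRelHypAction G X Par B)
    (hδ : IsDeltaHyperbolic X δ) {x₀ : X} (hx₀ : x₀ ∉ horoballUnion G B)
    (H : ∀ ξ, IsParabolicPoint G ξ → HoroData (B ξ) (f ξ) D) {Q : Subgroup G}
    (hQ : IsRelQuasiconvex B x₀ Q) (c : ℝ) :
    ∃ C, ∀ ξ, IsParabolicPoint G ξ → ∀ h ∈ Q, (∃ y ∈ B ξ, dist (h • x₀) y ≤ c) →
      ∀ q ∈ Q, ∀ (S T : Set X) (y p p' : X), IsGeodesicSegment S x₀ (q • x₀) →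
      IsGeodesicSegment T (q • x₀) y → p ∈ S → p' ∈ T →
      9 * D + δ + 2 < f ξ p → 9 * D + δ + 2 < f ξ p' →
        ∃ k ∈ Q, k • h⁻¹ • ξ = h⁻¹ • ξ ∧ ∃ u ∈ T, dist (h • k • x₀) u ≤ C := by
  obtain ⟨μ, hμ, hQ⟩ := hQ
  obtain ⟨C, hC⟩ := hG.exists_near_stabilizer hx₀ Q (max c (μ + 1))
  refine ⟨C + μ + (2 * δ + 10 * D + 2), ?_⟩
  rintro ξ hξ h hh ⟨b, hb, hbd⟩ q hq S T y p p' hS hT hp hp' hhp hhp'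
  have hqx : q • x₀ ∉ horoballUnion G B := fun h => hx₀ ((hG.smul_mem_horoballUnion q x₀).1 h)
  obtain ⟨u, hu, u', hu', huU, -, ⟨v, hv, huv⟩, hd⟩ :=
    hG.exists_common_entry hδ hξ (H ξ hξ) hqx hS.symm hT hp hp' hhp hhp'
  obtain ⟨q₂, hq₂, hd₂⟩ := hQ 1 Q.one_mem q hq S (by rwa [one_smul]) u hu huU
  obtain ⟨k, hk, hkξ, hkd⟩ := hC (h⁻¹ • ξ) (hξ.smul _)
    ⟨h⁻¹ • b, (hG.smul_mem_iff hξ _ _).2 hb, by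
      rw [← dist_smul h, smul_inv_smul]; exact hbd.trans (le_max_left _ _)⟩ (h⁻¹ * q₂)
    (Q.mul_mem (Q.inv_mem hh) hq₂)
    ⟨h⁻¹ • v, (hG.smul_mem_iff hξ _ _).2 hv, by
      rw [mul_smul, dist_smul]
      refine le_trans ?_ (le_max_right _ _)
      rw [dist_comm] at hd₂
      linarith [dist_triangle (q₂ • x₀) u v]⟩
  refine ⟨k, hk, hkξ, u', hu', ?_⟩
  rw [← dist_smul h, mul_smul, smul_inv_smul] at hkd
  have := dist_triangle4 (h • k • x₀) (q₂ • x₀) u u'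
  rw [dist_comm (h • k • x₀) (q₂ • x₀), dist_comm (q₂ • x₀) u] at this
  linarith

/-- Every geodesic from `Q x₀` to `R x₀` passes near the orbit of `Q ⊓ R`. -/
theorem exists_inf_near_segment (hG : IsRelHypAction G X Par B) {x₀ : X}
    (hx₀ : x₀ ∉ horoballUnion G B) {Q R : Subgroup G} (hQ : IsRelQuasiconvex B x₀ Q)
    (hR : IsRelQuasiconvex B x₀ R) (hQR : HaveCompatibleParabolics X Q R) :
    ∃ C, ∀ q ∈ Q, ∀ r ∈ R, ∃ h ∈ Q ⊓ R,
      dist (q • x₀) (h • x₀) + dist (h • x₀) (r • x₀) ≤ dist (q • x₀) (r • x₀) + 2 * C := by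
  obtain ⟨δ, hδ⟩ := hG.hyperbolic
  obtain ⟨D, hD, hH⟩ := hG.exists_uniform_horoData hx₀
  choose! f H using hH
  have hX := hG.geodesic
  have hδ0 := hδ.nonneg x₀
  obtain ⟨μ, hμ, hμQ⟩ := id hQ
  obtain ⟨ν, hν, hνR⟩ := id hR
  set T := 9 * D + δ + 2
  -- The points `a, b, p` below are within `2 * (δ + 1)` of each other and heights are coarsely
  -- Lipschitz, so `a` or `b` above `K` forces all three above `T`.
  set K := T + 2 * (δ + 1) + 2 * D
  have hK : 0 ≤ K := by positivity
  set c₁ := 2 * δ + 10 * D + 2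
  obtain ⟨C₁, hC₁⟩ := exists_near_inf Q R x₀ (2 * (K + 5 * D + 1 + δ + 1) + μ + ν)
  obtain ⟨C₂, hC₂⟩ := exists_near_inf Q R x₀ (μ + c₁ + ν)
  obtain ⟨C₃, hC₃⟩ := hG.exists_near_stabilizer_of_deep hδ hx₀ H hQ (C₂ + μ + 1)
  obtain ⟨C₄, hC₄⟩ := hG.exists_near_stabilizer_of_deep hδ hx₀ H hR (C₂ + μ + 1)
  suffices h : ∃ C, ∀ q ∈ Q, ∀ r ∈ R, ∃ S, IsGeodesicSegment S (q • x₀) (r • x₀) ∧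
      ∃ h ∈ Q ⊓ R, ∃ u ∈ S, dist (h • x₀) u ≤ C by
    obtain ⟨C, hC⟩ := h
    refine ⟨C, fun q hq r hr => ?_⟩
    obtain ⟨S, hS, h, hh, u, hu, hd⟩ := hC q hq r hr
    exact ⟨h, hh, hS.dist_add_le hu hd⟩
  refine ⟨max (C₁ + μ + (K + 5 * D + 1 + δ + 1)) (max C₃ C₄), fun q hq r hr => ?_⟩
  have hUx : ∀ g : G, g • x₀ ∉ horoballUnion G B :=
    fun g h => hx₀ ((hG.smul_mem_horoballUnion g x₀).1 h)
  obtain ⟨α, hα⟩ := hX x₀ (q • x₀)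
  obtain ⟨β, hβ⟩ := hX x₀ (r • x₀)
  obtain ⟨γ, hγ⟩ := hX (q • x₀) (r • x₀)
  refine ⟨γ, hγ, ?_⟩
  obtain ⟨p, hp, ⟨b, hb, hpb⟩, a, ha, hpa⟩ := exists_triangle_center hδ hγ hβ.symm hα.symm
  have hμ' : ∀ u ∈ α, u ∉ horoballUnion G B → ∃ q ∈ Q, dist u (q • x₀) ≤ μ :=
    hμQ 1 Q.one_mem q hq α (by rwa [one_smul])
  have hν' : ∀ u ∈ β, u ∉ horoballUnion G B → ∃ r ∈ R, dist u (r • x₀) ≤ ν :=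
    hνR 1 R.one_mem r hr β (by rwa [one_smul])
  by_cases hdeep : ∃ ξ, IsParabolicPoint G ξ ∧ (K < f ξ a ∨ K < f ξ b)
  · obtain ⟨ξ, hξ, hab⟩ := hdeep
    have Hξ := H ξ hξ
    have l1 := Hξ.lipschitz hX a p
    have l2 := Hξ.lipschitz hX b p
    have l3 := Hξ.lipschitz hX a b
    have l4 := Hξ.lipschitz hX b a
    have l5 := dist_triangle a p b
    rw [dist_comm a p] at l1 l5
    rw [dist_comm b p] at l2
    rw [dist_comm b a] at l4
    have hTa : T < f ξ a := by rcases hab with h | h <;> linarith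
    have hTb : T < f ξ b := by rcases hab with h | h <;> linarith
    have hTp : T < f ξ p := by rcases hab with h | h <;> linarith
    obtain ⟨u, hu, v, hv, huU, hvU, ⟨w, hw, huw⟩, huv⟩ :=
      hG.exists_common_entry hδ hξ Hξ hx₀ hα hβ ha hb hTa hTb
    obtain ⟨q₁, hq₁, hd₁⟩ := hμ' u hu huU
    obtain ⟨r₁, hr₁, hd₂⟩ := hν' v hv hvU
    obtain ⟨h, hh, hqh⟩ := hC₂ q₁ hq₁ r₁ hr₁ (by
      rw [dist_comm] at hd₁
      linarith [dist_triangle4 (q₁ • x₀) u v (r₁ • x₀)])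
    have hnear : ∃ y ∈ B ξ, dist (h • x₀) y ≤ C₂ + μ + 1 := ⟨w, hw, by
      rw [dist_comm] at hd₁ hqh
      linarith [dist_triangle4 (h • x₀) (q₁ • x₀) u w]⟩
    have hmax := hG.isMaximalParabolic_stabilizer hx₀ (hξ.smul h⁻¹)
    -- The smaller parabolic part decides the corner: at `q • x₀` the stabilizing element is found
    -- in `Q` and lies in `R` by inclusion, and at `r • x₀` the roles are exchanged.
    rcases hQR _ hmax with hle | hle
    · obtain ⟨k, hk, hkξ, u', hu', hd⟩ :=
        hC₃ ξ hξ h hh.1 hnear q hq α γ _ a p hα hγ ha hp hTa hTp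
      have hkR : k ∈ R := (hle ⟨hk, hkξ⟩).1
      refine ⟨h * k, mul_mem hh ⟨hk, hkR⟩, u', hu', ?_⟩
      rw [mul_smul]
      exact hd.trans ((le_max_left _ _).trans (le_max_right _ _))
    · obtain ⟨k, hk, hkξ, u', hu', hd⟩ :=
        hC₄ ξ hξ h hh.2 hnear r hr β γ _ b p hβ hγ.symm hb hp hTb hTp
      have hkQ : k ∈ Q := (hle ⟨hk, hkξ⟩).1
      refine ⟨h * k, mul_mem hh ⟨hkQ, hk⟩, u', hu', ?_⟩
      rw [mul_smul]
      exact hd.trans ((le_max_right _ _).trans (le_max_right _ _))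
  · push Not at hdeep
    obtain ⟨u, hu, huU, hau⟩ := hG.exists_near_notMem hD H hα hx₀ (hUx q) ha hK
      (fun ξ hξ _ => (hdeep ξ hξ).1)
    obtain ⟨v, hv, hvU, hbv⟩ := hG.exists_near_notMem hD H hβ hx₀ (hUx r) hb hK
      (fun ξ hξ _ => (hdeep ξ hξ).2)
    obtain ⟨q₁, hq₁, hd₁⟩ := hμ' u hu huU
    obtain ⟨r₁, hr₁, hd₂⟩ := hν' v hv hvU
    have e1 := dist_triangle4 p a u (q₁ • x₀)
    have e2 := dist_triangle4 p b v (r₁ • x₀)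
    obtain ⟨h, hh, hqh⟩ := hC₁ q₁ hq₁ r₁ hr₁ (by
      have := dist_triangle (q₁ • x₀) p (r₁ • x₀)
      rw [dist_comm _ p] at this
      linarith)
    refine ⟨h, hh, p, hp, le_trans ?_ (le_max_left _ _)⟩
    have := dist_triangle (h • x₀) (q₁ • x₀) p
    rw [dist_comm (h • x₀) (q₁ • x₀), dist_comm (q₁ • x₀) p] at this
    linarith

end IsRelHypAction

end Key

/-! ### Broken geodesics with long edges and small Gromov products. -/

section LocalToGlobal

variable {X : Type*} [MetricSpace X] {δ : ℝ}

theorem exists_le_le_succ (a : ℕ → ℝ) (t : ℝ) {n : ℕ} (hn : 0 < n) (h0 : a 0 ≤ t)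
    (h1 : t ≤ a n) : ∃ i < n, a i ≤ t ∧ t ≤ a (i + 1) := by
  induction n, hn using Nat.le_induction with
  | base => exact ⟨0, Nat.one_pos, h0, h1⟩
  | succ n hn ih =>
    rcases le_total t (a n) with h | h
    · obtain ⟨i, hi, h⟩ := ih h
      exact ⟨i, hi.trans n.lt_succ_self, h⟩
    · exact ⟨n, n.lt_succ_self, h, h1⟩

/-- In a broken geodesic with long edges and small Gromov products at the vertices, the vertices
are almost aligned with the origin. -/
theorem dist_origin_add_le (hX : IsGeodesicSpace X) (hδ : IsDeltaHyperbolic X δ) {C M : ℝ}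
    (hC : 0 ≤ C) (hM : 2 * C + 8 * (δ + 1) < M) {y : ℕ → X} {n : ℕ}
    (hy : ∀ i, i + 2 ≤ n → dist (y i) (y (i + 1)) + dist (y (i + 1)) (y (i + 2)) ≤
      dist (y i) (y (i + 2)) + 2 * C) (hlen : ∀ i < n, M ≤ dist (y i) (y (i + 1))) {i : ℕ}
    (hi : i < n) : dist (y 0) (y i) + dist (y i) (y (i + 1)) ≤
      dist (y 0) (y (i + 1)) + 2 * C + 4 * (δ + 1) := by
  have hδ0 := hδ.nonneg (y 0)
  induction i with
  | zero =>
    rw [dist_self]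
    linarith
  | succ i ih =>
    have ih := ih (by omega)
    have h1 := hy i hi
    have h2 := hlen i (by omega)
    have h3 := four_point hX hδ (y i) (y 0) (y (i + 2)) (y (i + 1))
    rw [dist_comm (y i) (y 0), dist_comm (y (i + 2)) (y (i + 1))] at h3
    rw [show i + 1 + 1 = i + 2 from rfl]
    -- One alternative contradicts the length of the edge from `y i` to `y (i + 1)`, by `ih` and
    -- `h1`; the other is the claim.
    rcases le_max_iff.1 (sub_le_iff_le_add.2 h3) with h4 | h4 <;> linarith

theorem dist_origin_pos (hX : IsGeodesicSpace X) (hδ : IsDeltaHyperbolic X δ) {C M : ℝ}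
    (hC : 0 ≤ C) (hM : 2 * C + 8 * (δ + 1) < M) {y : ℕ → X} {n : ℕ} (hn : 0 < n)
    (hy : ∀ i, i + 2 ≤ n → dist (y i) (y (i + 1)) + dist (y (i + 1)) (y (i + 2)) ≤
      dist (y i) (y (i + 2)) + 2 * C) (hlen : ∀ i < n, M ≤ dist (y i) (y (i + 1))) :
    0 < dist (y 0) (y n) := by
  obtain ⟨m, rfl⟩ := Nat.exists_eq_succ_of_ne_zero hn.ne'
  have h1 := dist_origin_add_le hX hδ hC hM hy hlen m.lt_succ_self
  have h2 := hlen m m.lt_succ_self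
  have h3 : 0 ≤ dist (y 0) (y m) := dist_nonneg
  have hδ0 := hδ.nonneg (y 0)
  rw [Nat.succ_eq_add_one]
  linarith

/-- The edge after `y i` is almost aligned with both ends of the path, the far end being treated by
reversing the path. The four-point inequality joins the two estimates across this long edge. -/
theorem dist_vertex_add_le (hX : IsGeodesicSpace X) (hδ : IsDeltaHyperbolic X δ) {C M : ℝ}
    (hC : 0 ≤ C) (hM : 2 * C + 8 * (δ + 1) < M) {y : ℕ → X} {n : ℕ}
    (hy : ∀ i, i + 2 ≤ n → dist (y i) (y (i + 1)) + dist (y (i + 1)) (y (i + 2)) ≤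
      dist (y i) (y (i + 2)) + 2 * C) (hlen : ∀ i < n, M ≤ dist (y i) (y (i + 1))) {i : ℕ}
    (hi : i ≤ n) : dist (y 0) (y i) + dist (y i) (y n) ≤
      dist (y 0) (y n) + 2 * (C + 4 * (δ + 1)) := by
  have hδ0 := hδ.nonneg (y 0)
  rcases hi.eq_or_lt with rfl | hi
  · rw [dist_self]
    linarith
  have h1 := dist_origin_add_le hX hδ hC hM hy hlen hi
  have h2 := dist_origin_add_le hX hδ hC hM (y := fun i => y (n - i)) (n := n) (i := n - i - 1)
    (fun j hj => by
      have := hy (n - j - 2) (by omega)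
      rw [show n - j - 2 + 2 = n - j by omega, show n - j - 2 + 1 = n - (j + 1) by omega,
        show n - j - 2 = n - (j + 2) by omega] at this
      rw [dist_comm (y (n - j)) (y (n - (j + 1))), dist_comm (y (n - (j + 1))) (y (n - (j + 2))),
        dist_comm (y (n - j)) (y (n - (j + 2)))]
      linarith)
    (fun j hj => by
      have := hlen (n - (j + 1)) (by omega)
      rwa [show n - (j + 1) + 1 = n - j by omega, dist_comm] at this) (by omega)
  rw [show n - 0 = n by omega, show n - (n - i - 1) = i + 1 by omega,
    show n - (n - i - 1 + 1) = i by omega] at h2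
  have h3 := hlen i hi
  have h4 := four_point hX hδ (y 0) (y n) (y (i + 1)) (y i)
  rw [dist_comm (y (i + 1)) (y i)] at h2 h4
  rw [dist_comm (y i) (y n)]
  rcases le_max_iff.1 (sub_le_iff_le_add.2 h4) with h5 | h5 <;> linarith

/-- A geodesic with the endpoints of a broken geodesic with long edges and small Gromov products
at the vertices stays near the broken geodesic. -/
theorem exists_near_edge (hX : IsGeodesicSpace X) (hδ : IsDeltaHyperbolic X δ) {C M : ℝ}
    (hC : 0 ≤ C) (hM : 2 * C + 8 * (δ + 1) < M) {y : ℕ → X} {n : ℕ} (hn : 0 < n)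
    (hy : ∀ i, i + 2 ≤ n → dist (y i) (y (i + 1)) + dist (y (i + 1)) (y (i + 2)) ≤
      dist (y i) (y (i + 2)) + 2 * C) (hlen : ∀ i < n, M ≤ dist (y i) (y (i + 1)))
    {S : Set X} (hS : IsGeodesicSegment S (y 0) (y n)) {p : X} (hp : p ∈ S) :
    ∃ i < n, ∀ T, IsGeodesicSegment T (y i) (y (i + 1)) →
      ∃ u ∈ T, dist p u ≤ C + 6 * (δ + 1) + 2 * δ := by
  have hδ0 := hδ.nonneg (y 0)
  have hS' := hS
  obtain ⟨c, L, hc, rfl⟩ := hS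
  obtain ⟨t, ht, rfl⟩ := hp
  -- Here `s` is the time of a point of the geodesic near `y i`, forced to be `0` and `L` at the
  -- ends so that some consecutive pair encloses `t`. These times are not claimed to be monotone.
  have hex : ∀ i, ∃ s : ℝ, (i = 0 → s = 0) ∧ (i = n → s = L) ∧
      (i ≤ n → s ∈ Icc 0 L ∧ dist (y i) (c s) ≤ C + 6 * (δ + 1)) := fun i => by
    rcases Nat.eq_zero_or_pos i with rfl | hi
    · refine ⟨0, fun _ => rfl, fun h => (hn.ne h).elim, fun _ => ⟨⟨le_rfl, hc.nonneg⟩, ?_⟩⟩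
      rw [hc.source, dist_self]
      positivity
    rcases eq_or_ne i n with rfl | hin
    · refine ⟨L, fun h => (hn.ne' h).elim, fun _ => rfl, fun _ => ⟨⟨hc.nonneg, le_rfl⟩, ?_⟩⟩
      rw [hc.target, dist_self]
      positivity
    by_cases hle : i ≤ n
    · obtain ⟨_, ⟨s, hs, rfl⟩, hd⟩ := exists_near_of_dist_add_le hX hδ hS'
        (dist_vertex_add_le hX hδ hC hM hy hlen hle)
      exact ⟨s, fun h => (hi.ne' h).elim, fun h => (hin h).elim, fun _ => ⟨hs, by linarith⟩⟩
    · exact ⟨0, fun _ => rfl, fun h => (hin h).elim, fun h => (hle h).elim⟩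
  choose s hs0 hsn hs using hex
  obtain ⟨i, hi, h1, h2⟩ := exists_le_le_succ s t hn (by rw [hs0 0 rfl]; exact ht.1)
    (by rw [hsn n rfl]; exact ht.2)
  refine ⟨i, hi, fun T hT => ?_⟩
  obtain ⟨m1, d1⟩ := hs i hi.le
  obtain ⟨m2, d2⟩ := hs (i + 1) hi
  obtain ⟨E, hE⟩ := hX (c (s (i + 1))) (y (i + 1))
  obtain ⟨F, hF⟩ := hX (c (s i)) (y i)
  obtain ⟨q, (hq | hq) | hq, hd⟩ := slim_quadrilateral hX hδ
    (hc.segment_sub m1.1 (h1.trans h2) m2.2) hE hT.symm hF (p := c t) ⟨t, ⟨h1, h2⟩, rfl⟩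
  · refine ⟨y (i + 1), hT.right_mem, ?_⟩
    have e1 := hE.dist_add hq
    have e2 := dist_triangle (c t) q (y (i + 1))
    rw [dist_comm (y (i + 1))] at d2
    linarith [dist_nonneg (x := c (s (i + 1))) (y := q)]
  · exact ⟨q, hq, by linarith⟩
  · refine ⟨y i, hT.left_mem, ?_⟩
    have e1 := hF.dist_add hq
    have e2 := dist_triangle (c t) q (y i)
    rw [dist_comm (y i)] at d1
    linarith [dist_nonneg (x := c (s i)) (y := q)]

end LocalToGlobal

/-! ### Alternating words in an amalgam. -/

section Words

variable {G : Type*} [Group G]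

/-- The elements `v 0, …, v n` are the partial products of an alternating word of length `n`: the
`i`-th letter lies in `Q` or in `R` according to `k i`, but not in `Q ⊓ R`. -/
structure IsAlternating (Q R : Subgroup G) (k : ℕ → Bool) (n : ℕ) (v : ℕ → G) : Prop where
  alternate : ∀ i, k (i + 1) = !k i
  mem : ∀ i < n, (v i)⁻¹ * v (i + 1) ∈ pair Q R (k i)
  notMem : ∀ i < n, (v i)⁻¹ * v (i + 1) ∉ Q ⊓ R

theorem pair_le_sup (Q R : Subgroup G) : ∀ b, pair Q R b ≤ Q ⊔ R
  | true => le_sup_left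
  | false => le_sup_right

theorem IsAlternating.mem_sup {Q R : Subgroup G} {k : ℕ → Bool} {n : ℕ} {v : ℕ → G}
    (h : IsAlternating Q R k n v) (h0 : v 0 = 1) {i : ℕ} (hi : i ≤ n) : v i ∈ Q ⊔ R := by
  induction i with
  | zero => rw [h0]; exact one_mem _
  | succ i ih =>
    have := mul_mem (ih (by omega)) (pair_le_sup Q R _ (h.mem i hi))
    rwa [mul_inv_cancel_left] at this

theorem IsAlternating.update {Q R : Subgroup G} {k : ℕ → Bool} {n : ℕ} {v : ℕ → G}
    (h : IsAlternating Q R k n v) {g : G} (hg : g ∈ Q ⊓ R) (i : ℕ) :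
    IsAlternating Q R k n (Function.update v i (v i * g)) := by
  have key : ∀ j, ∃ a ∈ Q ⊓ R, ∃ b ∈ Q ⊓ R, (Function.update v i (v i * g) j)⁻¹ *
      Function.update v i (v i * g) (j + 1) = a * ((v j)⁻¹ * v (j + 1)) * b := fun j => by
    by_cases h1 : j = i
    · subst h1
      exact ⟨g⁻¹, inv_mem hg, 1, one_mem _, by
        rw [Function.update_self, Function.update_of_ne (by omega)]; group⟩
    by_cases h2 : j + 1 = i
    · subst h2
      exact ⟨1, one_mem _, g, hg, by
        rw [Function.update_self, Function.update_of_ne (by omega)]; group⟩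
    · exact ⟨1, one_mem _, 1, one_mem _, by
        rw [Function.update_of_ne h1, Function.update_of_ne h2]; group⟩
  refine ⟨h.alternate, fun j hj => ?_, fun j hj hmem => h.notMem j hj ?_⟩
  · obtain ⟨a, ha, b, hb, e⟩ := key j
    rw [e]
    exact mul_mem (mul_mem (inf_le_pair Q R _ ha) (h.mem j hj)) (inf_le_pair Q R _ hb)
  · obtain ⟨a, ha, b, hb, e⟩ := key j
    rw [e] at hmem
    rwa [(Q ⊓ R).mul_mem_cancel_right hb, (Q ⊓ R).mul_mem_cancel_left ha] at hmem

theorem amalgamMap_of {Q R : Subgroup G} (b : Bool) (g : pair Q R b) :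
    amalgamMap Q R (Monoid.PushoutI.of b g) = g :=
  Monoid.PushoutI.lift_of _ _ _ _

theorem amalgamMap_base {Q R : Subgroup G} (h : (Q ⊓ R : Subgroup G)) :
    amalgamMap Q R (Monoid.PushoutI.base _ h) = h :=
  Monoid.PushoutI.lift_base _ _ _ _

/-- Induction on normal words. The first index is recorded so that prepending a letter preserves
alternation. -/
theorem exists_isAlternating_of_normalWord {Q R : Subgroup G}
    {d : Monoid.PushoutI.NormalWord.Transversal
      (fun b => Subgroup.inclusion (inf_le_pair Q R b))}
    (w : Monoid.PushoutI.NormalWord d) :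
    (∃ h, w.prod = Monoid.PushoutI.base _ h) ∨
      ∃ n k v, 0 < n ∧ IsAlternating Q R k n v ∧ v 0 = 1 ∧ v n = amalgamMap Q R w.prod ∧
        w.fstIdx = some (k 0) := by
  classical
  induction w using Monoid.PushoutI.NormalWord.consRecOn with
  | empty => exact Or.inl ⟨1, by simp⟩
  | cons b g w hmw hgn hgr hw1 ih =>
    right
    have hg : (g : G) ∉ Q ⊓ R := fun h => hgr ⟨⟨g, h⟩, Subtype.ext rfl⟩
    rcases ih with ⟨h, hw⟩ | ⟨n, k, v, hn, hv, hv0, hvn, hk⟩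
    -- The remainder is a base element `h`, absorbed into the single letter `g`.
    · refine ⟨1, fun i => if Even i then b else !b, fun i => if i = 0 then 1 else g * h,
        one_pos, ⟨fun i => ?_, fun i hi => ?_, fun i hi => ?_⟩, rfl, ?_, ?_⟩
      · by_cases hi : Even i <;> simp [hi, Nat.even_add_one]
      · obtain rfl : i = 0 := by omega
        simpa using mul_mem g.2 (inf_le_pair Q R b h.2)
      · obtain rfl : i = 0 := by omega
        simpa [(Q ⊓ R).mul_mem_cancel_right h.2] using hg
      · rw [Monoid.PushoutI.NormalWord.prod_cons, hw, map_mul, amalgamMap_of, amalgamMap_base]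
        simp
      · simp [Monoid.PushoutI.NormalWord.cons, Monoid.CoprodI.Word.fstIdx,
          Monoid.CoprodI.Word.cons]
    · have hb : k 0 = !b := by
        rw [hk] at hmw
        have : k 0 ≠ b := fun h => hmw (by rw [h])
        exact Bool.eq_not.2 this
      refine ⟨n + 1, fun i => Nat.casesOn i b k, fun i => Nat.casesOn i 1 fun j => g * v j,
        n.succ_pos, ⟨fun i => ?_, fun i hi => ?_, fun i hi => ?_⟩, rfl, ?_, ?_⟩
      · cases i with
        | zero => exact hb
        | succ i => exact hv.alternate i
      · cases i with
        | zero => simp [hv0]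
        | succ i => simpa [mul_assoc] using hv.mem i (by omega)
      · cases i with
        | zero => simpa [hv0] using hg
        | succ i => simpa [mul_assoc] using hv.notMem i (by omega)
      · rw [Monoid.PushoutI.NormalWord.prod_cons, map_mul, amalgamMap_of, ← hvn]
      · simp [Monoid.PushoutI.NormalWord.cons, Monoid.CoprodI.Word.fstIdx,
          Monoid.CoprodI.Word.cons]
  | base h w hw ih =>
    rcases ih with ⟨h', hw'⟩ | ⟨n, k, v, hn, hv, hv0, hvn, hk⟩
    · exact Or.inl ⟨h * h', by rw [Monoid.PushoutI.NormalWord.prod_smul, hw', map_mul]⟩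
    · right
      have hne : ∀ i, i + 1 ≠ 0 := fun i => i.succ_ne_zero
      -- The base element is absorbed into the first letter, so every partial product but the
      -- initial one is multiplied by it.
      refine ⟨n, k, fun i => if i = 0 then 1 else h * v i, hn,
        ⟨hv.alternate, fun i hi => ?_, fun i hi => ?_⟩, rfl, ?_, ?_⟩
      · rcases eq_or_ne i 0 with rfl | hi0
        · have := mul_mem (inf_le_pair Q R (k 0) h.2) (hv.mem 0 hi)
          simpa [hv0] using this
        · simpa [hi0, mul_assoc] using hv.mem i hi
      · rcases eq_or_ne i 0 with rfl | hi0
        · have := hv.notMem 0 hi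
          rw [← (Q ⊓ R).mul_mem_cancel_left h.2] at this
          simpa [hv0] using this
        · simpa [hi0, mul_assoc] using hv.notMem i hi
      · rw [Monoid.PushoutI.NormalWord.prod_smul, map_mul, amalgamMap_base, ← hvn]
        simp [hn.ne']
      · rw [← hk]; rfl

/-- Every element of an amalgam lies in the base or is represented by an alternating word. -/
theorem exists_isAlternating (Q R : Subgroup G) (x : Amalgam Q R) :
    (∃ h, x = Monoid.PushoutI.base _ h) ∨
      ∃ n k v, 0 < n ∧ IsAlternating Q R k n v ∧ v 0 = 1 ∧ v n = amalgamMap Q R x := by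
  classical
  obtain ⟨d⟩ := Monoid.PushoutI.NormalWord.transversal_nonempty
    (fun b => Subgroup.inclusion (inf_le_pair Q R b))
    (fun b => Subgroup.inclusion_injective (inf_le_pair Q R b))
  obtain ⟨w, rfl⟩ : ∃ w : Monoid.PushoutI.NormalWord d, w.prod = x :=
    ⟨_, Monoid.PushoutI.NormalWord.equiv.symm_apply_apply x⟩
  exact (exists_isAlternating_of_normalWord w).imp_right
    fun ⟨n, k, v, hn, hv, h0, h1, _⟩ => ⟨n, k, v, hn, hv, h0, h1⟩

theorem sup_le_range_amalgamMap (Q R : Subgroup G) : Q ⊔ R ≤ (amalgamMap Q R).range :=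
  sup_le (fun q hq => ⟨_, amalgamMap_of true ⟨q, hq⟩⟩) (fun r hr => ⟨_, amalgamMap_of false ⟨r, hr⟩⟩)

end Words

/-! ### Separability, straightening of words, and the theorem. -/

section Main

/-- Only finitely many elements outside `H` move `x₀` by at most `M`; intersect finite index
subgroups excluding them one by one. -/
theorem IsSeparableSubgroup.exists_finiteIndex {G X : Type*} [Group G] [MetricSpace X]
    [MulAction G X] [ProperSpace X] [ProperlyDiscontinuousSMul G X] {H : Subgroup G} (hH : IsSeparableSubgroup H)
    (x₀ : X) (M : ℝ) : ∃ K : Subgroup G, K.FiniteIndex ∧ H ≤ K ∧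
      ∀ g ∈ K, g ∉ H → M < dist x₀ (g • x₀) := by
  set E := {g : G | dist x₀ (g • x₀) ≤ M} \ H
  have hE : E.Finite := (finite_dist_smul_le x₀ M).sdiff
  have hex : ∀ g : E, ∃ K : Subgroup G, K.FiniteIndex ∧ H ≤ K ∧ (g : G) ∉ K :=
    fun g => hH g g.2.2
  choose K hK hHK hgK using hex
  have := hE.to_subtype
  refine ⟨⨅ g, K g, Subgroup.finiteIndex_iInf hK, le_iInf hHK, fun g hg hgH => ?_⟩
  by_contra hM
  exact hgK ⟨g, not_lt.1 hM, hgH⟩ (Subgroup.mem_iInf.1 hg _)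

variable {G : Type*} {X : Type*} [Group G] [MetricSpace X] [MulAction G X] [IsIsometricSMul G X]

/-- Among the alternating words for a given element, one of almost minimal length has small
Gromov products at its vertices. -/
theorem IsAlternating.exists_straight {Q R : Subgroup G} {x₀ : X} {C : ℝ}
    (hC : ∀ q ∈ Q, ∀ r ∈ R, ∃ h ∈ Q ⊓ R, dist (q • x₀) (h • x₀) + dist (h • x₀) (r • x₀) ≤
      dist (q • x₀) (r • x₀) + 2 * C) {k : ℕ → Bool} {n : ℕ} {v : ℕ → G}
    (hv : IsAlternating Q R k n v) :
    ∃ w, IsAlternating Q R k n w ∧ w 0 = v 0 ∧ w n = v n ∧ ∀ i, i + 2 ≤ n →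
      dist (w i • x₀) (w (i + 1) • x₀) + dist (w (i + 1) • x₀) (w (i + 2) • x₀) ≤
        dist (w i • x₀) (w (i + 2) • x₀) + 2 * (C + 1) := by
  set len : (ℕ → G) → ℝ := fun w => ∑ i ∈ Finset.range n, dist (w i • x₀) (w (i + 1) • x₀)
  set A : Set ℝ := len '' {w | IsAlternating Q R k n w ∧ w 0 = v 0 ∧ w n = v n}
  have hbdd : BddBelow A := ⟨0, by
    rintro _ ⟨w, -, rfl⟩
    exact Finset.sum_nonneg fun i _ => dist_nonneg⟩
  obtain ⟨_, ⟨w, ⟨hw, hw0, hwn⟩, rfl⟩, hlt⟩ :=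
    Real.lt_sInf_add_pos (s := A) ⟨_, v, ⟨hv, rfl, rfl⟩, rfl⟩ one_pos
  refine ⟨w, hw, hw0, hwn, fun i hi => ?_⟩
  have hpair : ∀ b, ∀ q ∈ pair Q R b, ∀ r ∈ pair Q R (!b), ∃ h ∈ Q ⊓ R,
      dist (q • x₀) (h • x₀) + dist (h • x₀) (r • x₀) ≤ dist (q • x₀) (r • x₀) + 2 * C := by
    rintro (_ | _) q hq r hr
    · obtain ⟨h, hh, hd⟩ := hC r hr q hq
      refine ⟨h, hh, ?_⟩
      rw [dist_comm (r • x₀) (q • x₀), dist_comm (r • x₀) (h • x₀),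
        dist_comm (h • x₀) (q • x₀)] at hd
      linarith
    · exact hC q hq r hr
  have hq : (w (i + 1))⁻¹ * w i ∈ pair Q R (k i) := by
    have := inv_mem (hw.mem i (by omega))
    rwa [mul_inv_rev, inv_inv] at this
  have hr : (w (i + 1))⁻¹ * w (i + 2) ∈ pair Q R (!k i) := by
    rw [← hw.alternate]
    exact hw.mem (i + 1) (by omega)
  -- Seen from `w (i + 1)`, the two neighbours lie in different factors. Moving the vertex to `w (i
  -- + 1) * h` changes only two edges and shortens the path by less than `1`, by the choice of `w`.
  obtain ⟨h, hh, hd⟩ := hpair _ _ hq _ hr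
  set w' := Function.update w (i + 1) (w (i + 1) * h)
  have hmin : sInf A ≤ len w' := csInf_le hbdd ⟨w', ⟨hw.update hh _, by
    rw [← hw0]; exact Function.update_of_ne (by omega) _ _, by
    rw [← hwn]; exact Function.update_of_ne (by omega) _ _⟩, rfl⟩
  have e0 : w' i = w i := Function.update_of_ne (by omega) _ _
  have e1 : w' (i + 1) = w (i + 1) * h := Function.update_self _ _ _
  have e2 : w' (i + 2) = w (i + 2) := Function.update_of_ne (by omega) _ _
  have hsum : len w' - len w =
      (dist (w' i • x₀) (w' (i + 1) • x₀) - dist (w i • x₀) (w (i + 1) • x₀)) +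
      (dist (w' (i + 1) • x₀) (w' (i + 2) • x₀) -
        dist (w (i + 1) • x₀) (w (i + 2) • x₀)) := by
    simp only [len]
    rw [← Finset.sum_sub_distrib]
    refine Finset.sum_eq_add_of_mem i (i + 1) (Finset.mem_range.2 (by omega))
      (Finset.mem_range.2 (by omega)) (by omega) fun j _ hj => ?_
    have f0 : w' j = w j := Function.update_of_ne hj.2 _ _
    have f1 : w' (j + 1) = w (j + 1) := Function.update_of_ne (fun h => hj.1 (by omega)) _ _
    rw [f0, f1, sub_self]
  have t : ∀ a b : G, dist (((w (i + 1))⁻¹ * a) • x₀) (b • x₀) =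
      dist (a • x₀) ((w (i + 1) * b) • x₀) := fun a b => by
    rw [← dist_smul (w (i + 1)), ← mul_smul, ← mul_smul, mul_inv_cancel_left]
  rw [t, t, mul_inv_cancel_left, dist_comm (h • x₀), t, dist_comm (w (i + 2) • x₀)] at hd
  rw [e0, e1, e2] at hsum
  linarith

/-- The orbit of a subgroup stays near that of a subgroup of finite index. -/
theorem exists_near_finiteIndex {Q' Q : Subgroup G} (h : (Q'.subgroupOf Q).FiniteIndex) (x₀ : X) :
    ∃ C, ∀ q ∈ Q, ∃ q' ∈ Q', dist (q • x₀) (q' • x₀) ≤ C := by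
  have : Finite (Q ⧸ Q'.subgroupOf Q) := Subgroup.finite_quotient_of_finiteIndex
  obtain ⟨C, hC⟩ := (finite_range fun a : Q ⧸ Q'.subgroupOf Q =>
    dist x₀ ((a.out : G) • x₀)).bddAbove
  refine ⟨C, fun q hq => ?_⟩
  -- The coset of `q⁻¹` is used because in left cosets it is `q * a.out` that lies in `Q'`.
  set a : Q ⧸ Q'.subgroupOf Q := QuotientGroup.mk (⟨q, hq⟩ : Q)⁻¹
  refine ⟨q * (a.out : G), ?_, ?_⟩
  · have : (⟨q, hq⟩ : Q)⁻¹⁻¹ * a.out ∈ Q'.subgroupOf Q :=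
      QuotientGroup.eq.1 (QuotientGroup.out_eq' a).symm
    simpa [Subgroup.mem_subgroupOf] using this
  · rw [mul_smul, dist_smul]
    exact hC ⟨a, rfl⟩

variable [ProperSpace X] [ProperlyDiscontinuousSMul G X] {Par : Set (Subgroup G)}
  {B : Boundary X → Set X}

namespace IsRelHypAction

/-- Points outside the horoballs and near an edge of a broken geodesic with vertices in `S x₀` are
near `S x₀`. -/
theorem exists_near_orbit_of_near_edge (hG : IsRelHypAction G X Par B) {x₀ : X}
    (hx₀ : x₀ ∉ horoballUnion G B) {Q' Q S : Subgroup G} (hQ : IsRelQuasiconvex B x₀ Q)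
    (hfin : (Q'.subgroupOf Q).FiniteIndex) (hle : Q' ≤ Q) (hS : Q' ≤ S) (r : ℝ) :
    ∃ μ, ∀ g ∈ S, ∀ s ∈ Q', ∀ T, IsGeodesicSegment T (g • x₀) ((g * s) • x₀) → ∀ u ∈ T, ∀ p,
      p ∉ horoballUnion G B → dist p u ≤ r → ∃ a ∈ S, dist p (a • x₀) ≤ μ := by
  obtain ⟨D, hD, hH⟩ := hG.exists_uniform_horoData hx₀
  choose! f H using hH
  obtain ⟨μ, hμ, hμQ⟩ := hQ
  obtain ⟨C, hC⟩ := exists_near_finiteIndex hfin x₀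
  refine ⟨r + ((D + r + 2 * D) + 5 * D + 1) + μ + C, fun g hg s hs T hT u hu p hp hpu => ?_⟩
  have hr : 0 ≤ r := dist_nonneg.trans hpu
  have hUx : ∀ g : G, g • x₀ ∉ horoballUnion G B :=
    fun g h => hx₀ ((hG.smul_mem_horoballUnion g x₀).1 h)
  -- Since `p` is outside the horoballs, the nearby `u` is not high in any of them, hence is near a
  -- point of the edge outside all horoballs, to which quasiconvexity of `Q` applies.
  obtain ⟨u', hu', huU', huu'⟩ := hG.exists_near_notMem hD H hT (hUx g) (hUx _) hu
    (K := D + r + 2 * D) (by positivity) (fun ξ hξ _ => by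
      have h1 := (H ξ hξ).of_notMem p fun h => hp ⟨ξ, hξ, h⟩
      have h2 := (H ξ hξ).lipschitz hG.geodesic u p
      rw [dist_comm u p] at h2
      linarith)
  have hT' := hT.smul g⁻¹
  rw [← mul_smul, ← mul_smul, inv_mul_cancel_left, inv_mul_cancel] at hT'
  obtain ⟨q, hq, hd⟩ := hμQ 1 Q.one_mem s (hle hs) _ hT' (g⁻¹ • u') ⟨u', hu', rfl⟩
    (fun h => huU' ((hG.smul_mem_horoballUnion _ _).1 h))
  obtain ⟨q', hq', hd'⟩ := hC q hq
  refine ⟨g * q', mul_mem hg (hS hq'), ?_⟩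
  rw [← dist_smul g, smul_inv_smul] at hd
  rw [← dist_smul g] at hd'
  rw [mul_smul]
  have h1 := dist_triangle4 p u u' (g • q' • x₀)
  have h2 := dist_triangle u' (g • q • x₀) (g • q' • x₀)
  linarith

end IsRelHypAction

end Main

end RelHyp

theorem mainTheorem2 {G : Type*} {X : Type*} [Group G] [MetricSpace X] [ProperSpace X]
    [MulAction G X] [IsIsometricSMul G X] [ProperlyDiscontinuousSMul G X]
    (Par : Set (Subgroup G)) (B : RelHyp.Boundary X → Set X)
    (hG : RelHyp.IsRelHypAction G X Par B)
    (x₀ : X) (hx₀ : x₀ ∉ RelHyp.horoballUnion G B)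
    (Q R : Subgroup G)
    (hQ : RelHyp.IsRelQuasiconvex B x₀ Q) (hR : RelHyp.IsRelQuasiconvex B x₀ R)
    (hQR : RelHyp.HaveCompatibleParabolics X Q R)
    (hsep : RelHyp.IsSeparableSubgroup (Q ⊓ R)) :
    ∃ Q' R' : Subgroup G, Q' ≤ Q ∧ R' ≤ R ∧
      (Q'.subgroupOf Q).FiniteIndex ∧ (R'.subgroupOf R).FiniteIndex ∧
      Function.Injective (RelHyp.amalgamMap Q' R') ∧
      RelHyp.IsRelQuasiconvex B x₀ (Q' ⊔ R') := by
  open RelHyp in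
  obtain ⟨δ, hδ⟩ := hG.hyperbolic
  have hX := hG.geodesic
  have hδ0 := hδ.nonneg x₀
  obtain ⟨C₀, hC₀⟩ := hG.exists_inf_near_segment hx₀ hQ hR hQR
  set C := max C₀ 0
  have hC0 : 0 ≤ C := le_max_right _ _
  have hC₀C : C₀ ≤ C := le_max_left _ _
  -- This is the edge length needed by the local-to-global lemmas for Gromov products bounded by `C
  -- + 1`.
  set M := 2 * (C + 1) + 8 * (δ + 1) + 1
  have hM : 2 * (C + 1) + 8 * (δ + 1) < M := lt_add_one _
  obtain ⟨K, hK, hHK, hKM⟩ := hsep.exists_finiteIndex x₀ M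
  have hinf : (Q ⊓ K) ⊓ (R ⊓ K) = Q ⊓ R := by
    rw [← inf_inf_distrib_right]
    exact inf_eq_left.2 hHK
  have hpairK : ∀ b, pair (Q ⊓ K) (R ⊓ K) b ≤ K := fun b => by
    cases b
    · exact inf_le_right
    · exact inf_le_right
  have hfin : ∀ Q : Subgroup G, ((Q ⊓ K).subgroupOf Q).FiniteIndex := fun Q => by
    rw [Subgroup.inf_subgroupOf_left]
    infer_instance
  have hstraight : ∀ {k n v}, IsAlternating (Q ⊓ K) (R ⊓ K) k n v → v 0 = 1 →
      ∃ w, IsAlternating (Q ⊓ K) (R ⊓ K) k n w ∧ w 0 = 1 ∧ w n = v n ∧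
        (∀ i, i + 2 ≤ n →
          dist (w i • x₀) (w (i + 1) • x₀) + dist (w (i + 1) • x₀) (w (i + 2) • x₀) ≤
            dist (w i • x₀) (w (i + 2) • x₀) + 2 * (C + 1)) ∧
        ∀ i < n, M ≤ dist (w i • x₀) (w (i + 1) • x₀) := by
    intro k n v hv hv0
    obtain ⟨w, hw, hw0, hwn, hws⟩ := hv.exists_straight (x₀ := x₀) (C := C)
      (fun q hq r hr => by
        obtain ⟨h, hh, hd⟩ := hC₀ q hq.1 r hr.1
        exact ⟨h, hinf ▸ hh, by linarith⟩)
    refine ⟨w, hw, hw0.trans hv0, hwn, hws, fun i hi => ?_⟩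
    have := hKM _ (hpairK _ (hw.mem i hi)) (hinf ▸ hw.notMem i hi)
    rw [mul_smul, ← dist_smul (w i), smul_inv_smul] at this
    exact this.le
  refine ⟨Q ⊓ K, R ⊓ K, inf_le_left, inf_le_left, hfin Q, hfin R, ?_, ?_⟩
  · refine (injective_iff_map_eq_one _).2 fun x hx => ?_
    rcases exists_isAlternating _ _ x with ⟨h, rfl⟩ | ⟨n, k, v, hn, hv, hv0, hvn⟩
    · rw [amalgamMap_base] at hx
      obtain rfl : h = 1 := Subtype.ext hx
      exact map_one _
    · exfalso
      obtain ⟨w, hw, hw0, hwn, hws, hwM⟩ := hstraight hv hv0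
      have := dist_origin_pos hX hδ (by positivity) hM (y := fun i => w i • x₀) hn hws hwM
      rw [hw0, hwn, hvn, hx, dist_self] at this
      exact this.false
  · obtain ⟨μ₁, hμ₁⟩ := hG.exists_near_orbit_of_near_edge hx₀ hQ (hfin Q) inf_le_left
      (le_sup_left (b := R ⊓ K)) (C + 1 + 6 * (δ + 1) + 2 * δ)
    obtain ⟨μ₂, hμ₂⟩ := hG.exists_near_orbit_of_near_edge hx₀ hR (hfin R) inf_le_left
      (le_sup_right (a := Q ⊓ K)) (C + 1 + 6 * (δ + 1) + 2 * δ)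
    refine ⟨max 0 (max μ₁ μ₂), le_max_left _ _, fun g₁ hg₁ g₂ hg₂ S hS p hp hpU => ?_⟩
    have hedge : ∀ b, ∀ g ∈ (Q ⊓ K) ⊔ (R ⊓ K), ∀ s ∈ pair (Q ⊓ K) (R ⊓ K) b, ∀ T,
        IsGeodesicSegment T (g • x₀) ((g * s) • x₀) → ∀ u ∈ T, ∀ p, p ∉ horoballUnion G B →
        dist p u ≤ C + 1 + 6 * (δ + 1) + 2 * δ →
        ∃ a ∈ (Q ⊓ K) ⊔ (R ⊓ K), dist p (a • x₀) ≤ max 0 (max μ₁ μ₂) := by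
      rintro (_ | _) g hg s hs T hT u hu p hp hpu
      · obtain ⟨a, ha, hd⟩ := hμ₂ g hg s hs T hT u hu p hp hpu
        exact ⟨a, ha, hd.trans ((le_max_right _ _).trans (le_max_right _ _))⟩
      · obtain ⟨a, ha, hd⟩ := hμ₁ g hg s hs T hT u hu p hp hpu
        exact ⟨a, ha, hd.trans ((le_max_left _ _).trans (le_max_right _ _))⟩
    obtain ⟨x, hx⟩ := sup_le_range_amalgamMap _ _ (mul_mem (inv_mem hg₁) hg₂)
    rcases exists_isAlternating _ _ x with ⟨h, rfl⟩ | ⟨n, k, v, hn, hv, hv0, hvn⟩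
    · rw [amalgamMap_base] at hx
      -- For an element of the base, `S` itself is a single edge, which may be assigned to either
      -- factor.
      refine hedge true g₁ hg₁ h h.2.1 S ?_ p hp p hpU ?_
      · rwa [hx, mul_inv_cancel_left]
      · rw [dist_self]
        positivity
    · obtain ⟨w, hw, hw0, hwn, hws, hwM⟩ := hstraight hv hv0
      have hw' : g₁ * w n = g₂ := by rw [hwn, hvn, hx, mul_inv_cancel_left]
      have hS' : IsGeodesicSegment S (g₁ • w 0 • x₀) (g₁ • w n • x₀) := by
        rwa [hw0, one_smul, ← mul_smul, hw']
      obtain ⟨i, hi, hT⟩ := exists_near_edge hX hδ (by positivity) hM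
        (y := fun i => g₁ • w i • x₀) hn (by simpa only [dist_smul] using hws)
        (by simpa only [dist_smul] using hwM) hS' hp
      obtain ⟨T, hT'⟩ := hX (g₁ • w i • x₀) (g₁ • w (i + 1) • x₀)
      obtain ⟨u, hu, hd⟩ := hT T hT'
      refine hedge (k i) (g₁ * w i) (mul_mem hg₁ (hw.mem_sup hw0 hi.le)) _ (hw.mem i hi) T ?_
        u hu p hpU hd
      rwa [mul_assoc, mul_inv_cancel_left, mul_smul, mul_smul]
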